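/- Let $V$ be a non-zero finite-dimensional real vector space and $C\subset V$ a proper open convex cone (that is, $C$ is an open convex set, invariant under multiplication by positive scalars, with $\overline C\cap(-\overline C)=\{0\}$), with base-point $b\in C$. For $x\in V$ and $y\in C$ let $M(x,y)=\inf\{\lambda>0 : \lambda y-x\in\overline C\}$. Let $F(x,y)=\log M(x,y)$ be the Funk metric, let $d_T(x,y)=\log\max(M(x,y),M(y,x))$ be the Thompson metric on $C$, and let $D=\{x\in C:\varphi(x)=1\}$ be a cross section of $C$, where $\varphi$ is a linear functional that is strictly positive on $\overline C\setminus\{0\}$; put $\partial D=\overline D\setminus D$. For a (possibly asymmetric) distance $d$ on a set $X$ with base-point $b_X$, put $\psi_z(x)=d(x,z)-d(b_X,z)$. The horofunction boundary is $X(\infty)=\overline{\{\psi_z : z\in X\}}\setminus\{\psi_z : z\in X\}$, for the topology of uniform convergence on the sets that are bounded for $d(x,y)+d(y,x)$; its elements are the horofunctions. A sequence or path in $X$ converges to a function if the corresponding functions $\psi_z$ do so in this topology. An almost-geodesic is a map $\gamma\colon T\to X$, where $0\in T\subset[0,\infty)$ and $\sup T\in(0,\infty]$ is a limit point of $T$ not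 in $T$, such that for each $\varepsilon>0$ there is $N<\sup T$ with $|d(\gamma(0),\gamma(s))+d(\gamma(s),\gamma(t))-t|<\varepsilon$ for all $s,t\in T$ with $N\le s\le t$. A Busemann point is a horofunction that is the limit, as $t\to\sup T$, of an almost-geodesic $\gamma\colon T\to X$. For $x\in\overline D$ let $r_x(y)=F(x,y)-F(x,b)$, and for $x\in D$ let $f_{C,x}(y)=\log\bigl(M(y,x)/M(b,x)\bigr)$, for $y\in C$. For $x\in\partial D$, let $A(x)$ (respectively $B(x)$) be the set of horofunctions (respectively Busemann points) of $(D,F)$, with base-point $b/\varphi(b)$, that are limits of a sequence in $D$ converging to $x$ in the usual topology. Each such $f$ is extended to $C$ by $f(y)=f\bigl(y/\varphi(y)\bigr)+\log\bigl(\varphi(y)/\varphi(b)\bigr)$. For $c\in\overline{\mathbb R}=\mathbb R\cup\{\pm\infty\}$ put $$[r_x,f,c]=\max\bigl(r_x+\min(c,0),\ f-\max(c,0)\bigr),$$ so that $[r_x,f,+\infty]=r_x$ and $[r_x,f,-\infty]=f$. Then the horofunction boundary of $(C,d_T)$, with base-point $b$, is $$C(\infty)=\{r_x : x\in D\}\cup\{f_{C,x}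 : x\in D\}\cup\{[r_x,f,c] : x\in\partial D,\ f\in A(x),\ c\in\overline{\mathbb R}\},$$ and the set of Busemann points of $(C,d_T)$ is $$\{r_x : x\in D\}\cup\{f_{C,x} : x\in D\}\cup\{[r_x,f,c] : x\in\partial D,\ f\in B(x),\ c\in\overline{\mathbb R}\}.$$ -/

import Mathlib

open Set Filter Topology
open scoped UniformConvergence

namespace ThompsonHoro

noncomputable section

section HorofunctionBoundary

/-! Horofunctions and Busemann points of a set `X` with a (possibly asymmetric) distance
`d : X → X → ℝ` and base-point `b`. -/

variable {X : Type*}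

/-- The subsets of `X` that are bounded for the symmetrised distance `d x y + d y x`. -/
def symBounded (d : X → X → ℝ) : Set (Set X) :=
  {S | ∃ R : ℝ, ∀ x ∈ S, ∀ y ∈ S, d x y + d y x ≤ R}

/-- The function `x ↦ d x z - d b z`, as an element of the space of real functions on `X` with the
topology of uniform convergence on the sets bounded for the symmetrised distance. -/
def horoMap (d : X → X → ℝ) (b z : X) : X →ᵤ[symBounded d] ℝ :=
  UniformOnFun.ofFun (symBounded d) (fun x => d x z - d b z)

/-- The points `z i` converge, along `l`, to the function `ξ` in the horofunction
compactification: `d · (z i) - d b (z i)` tends to `ξ`, uniformly on bounded sets. -/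
def HoroConverges (d : X → X → ℝ) (b : X) {ι : Type*} (l : Filter ι) (z : ι → X)
    (ξ : X → ℝ) : Prop :=
  Tendsto (fun i => horoMap d b (z i)) l (𝓝 (UniformOnFun.ofFun (symBounded d) ξ))

/-- The horofunction boundary `X(∞)`: the closure of the set of functions `d · z - d b z`,
minus this set. (A limit, uniform on bounded sets, of these functions is continuous, so it makes no
difference whether the closure is taken in all functions or in the continuous ones.) -/
def horofunctionBoundary (d : X → X → ℝ) (b : X) : Set (X → ℝ) :=
  {ξ | UniformOnFun.ofFun (symBounded d) ξ ∈ closure (range (horoMap d b)) \ range (horoMap d b)}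

/-- `γ`, restricted to the parameter set `T`, is an almost-geodesic. The set `T ⊆ [0, ∞)` contains
`0`, and `sup T ∈ (0, ∞]` is a limit point of `T` that is not in `T`, which amounts to `T` having no
greatest element. An almost-geodesic of a genuine metric that leaves every bounded set
has `sup T = ∞`. -/
structure IsAlmostGeodesic (d : X → X → ℝ) (T : Set ℝ) (γ : ℝ → X) : Prop where
  nonneg : ∀ t ∈ T, 0 ≤ t
  zero_mem : (0 : ℝ) ∈ T
  exists_gt : ∀ t ∈ T, ∃ t' ∈ T, t < t'
  almost : ∀ ε : ℝ, 0 < ε → ∃ N ∈ T, ∀ s ∈ T, ∀ t ∈ T, N ≤ s → s ≤ t →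
    |d (γ 0) (γ s) + d (γ s) (γ t) - t| < ε

/-- The Busemann points: the horofunctions that are limits of almost-geodesics. The filter
`atTop` on `T` is that of `t → sup T` in `T`. -/
def busemannPoints (d : X → X → ℝ) (b : X) : Set (X → ℝ) :=
  {ξ | ξ ∈ horofunctionBoundary d b ∧ ∃ (T : Set ℝ) (γ : ℝ → X), IsAlmostGeodesic d T γ ∧
    HoroConverges d b (atTop : Filter T) (fun t : T => γ t) ξ}

/-- `[f₁, f₂, c] = (f₁ + c⁻) ∨ (f₂ - c⁺)`, with `c⁻ = c ∧ 0` and `c⁺ = c ∨ 0`, for `c` an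
extended real number. It equals `f₁` if `c = ∞` and `f₂` if `c = -∞`. -/
def bracket (f₁ f₂ : X → ℝ) (c : EReal) : X → ℝ :=
  fun y => (max ((f₁ y : EReal) + min c 0) ((f₂ y : EReal) - max c 0)).toReal

theorem bracket_coe (f₁ f₂ : X → ℝ) (c : ℝ) (y : X) :
    bracket f₁ f₂ (c : EReal) y = max (f₁ y + min c 0) (f₂ y - max c 0) := by
  unfold bracket
  rw [← EReal.coe_zero, ← EReal.coe_strictMono.monotone.map_min,
    ← EReal.coe_strictMono.monotone.map_max, ← EReal.coe_add, ← EReal.coe_sub,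
    ← EReal.coe_strictMono.monotone.map_max, EReal.toReal_coe]

theorem bracket_top (f₁ f₂ : X → ℝ) : bracket f₁ f₂ ⊤ = f₁ := by
  funext y
  simp [bracket]

theorem bracket_bot (f₁ f₂ : X → ℝ) : bracket f₁ f₂ ⊥ = f₂ := by
  funext y
  simp [bracket]

end HorofunctionBoundary

section Cone

variable {V : Type*} [NormedAddCommGroup V] [NormedSpace ℝ V]

/-- A proper open convex cone in `V`. -/
structure ProperOpenCone (V : Type*) [NormedAddCommGroup V] [NormedSpace ℝ V] extends
    ConvexCone ℝ V where
  isOpen : IsOpen carrier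
  proper : closure carrier ∩ -closure carrier = {0}

/-- The order `x ≤_C y` defined by the cone. -/
def ProperOpenCone.le (C : ProperOpenCone V) (x y : V) : Prop := y - x ∈ closure C.carrier

/-- The gauge `M(x, y) = inf {t > 0 | x ≤_C t y}`; it is used for `y ∈ C`. -/
def ProperOpenCone.gauge (C : ProperOpenCone V) (x y : V) : ℝ :=
  sInf {t : ℝ | 0 < t ∧ C.le x (t • y)}

/-- The Funk metric. -/
def ProperOpenCone.funk (C : ProperOpenCone V) (x y : V) : ℝ := Real.log (C.gauge x y)

/-- The reverse-Funk metric. -/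
def ProperOpenCone.rfunk (C : ProperOpenCone V) (x y : V) : ℝ := C.funk y x

/-- Thompson's metric on the cone. -/
def ProperOpenCone.thompson (C : ProperOpenCone V) (x y : C.carrier) : ℝ :=
  Real.log (max (C.gauge x y) (C.gauge y x))

/-- `r_x = R(·, x) - R(b, x)`, as a function on the cone; `R` is the reverse-Funk metric. -/
def ProperOpenCone.r (C : ProperOpenCone V) (b : C.carrier) (x : V) : C.carrier → ℝ :=
  fun y => C.rfunk y x - C.rfunk b x

/-- `f_{C,x} = log (M(·, x) / M(b, x))`, as a function on the cone. -/
def ProperOpenCone.fC (C : ProperOpenCone V) (b : C.carrier) (x : V) : C.carrier → ℝ :=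
  fun y => Real.log (C.gauge y x / C.gauge b x)

theorem ProperOpenCone.ne_zero_of_mem [Nontrivial V] (C : ProperOpenCone V) {x : V}
    (hx : x ∈ C.carrier) : x ≠ 0 := by
  rintro rfl
  have huniv : C.carrier = univ := by
    refine eq_univ_of_forall fun v => ?_
    have hc : Tendsto (fun t : ℝ => t • v) (𝓝[>] 0) (𝓝 ((0 : ℝ) • v)) :=
      ((continuous_id.smul continuous_const).tendsto 0).mono_left nhdsWithin_le_nhds
    rw [zero_smul] at hc
    obtain ⟨t, htC, ht⟩ :=
      ((hc.eventually (C.isOpen.mem_nhds hx)).and self_mem_nhdsWithin).exists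
    have h := C.smul_mem' (inv_pos.mpr (mem_Ioi.mp ht)) htC
    rwa [inv_smul_smul₀ (ne_of_gt (mem_Ioi.mp ht))] at h
  obtain ⟨v, hv⟩ := exists_ne (0 : V)
  have h : v ∈ closure C.carrier ∩ -closure C.carrier := by
    rw [huniv]
    simp
  rw [C.proper] at h
  exact hv h

/-- A cross section `D = {x ∈ C | φ x = 1}` of the cone, given by a linear functional `φ` that is
positive for the order of the cone. -/
structure CrossSection (C : ProperOpenCone V) where
  functional : V →ₗ[ℝ] ℝ
  pos : ∀ x ∈ closure C.carrier, x ≠ 0 → 0 < functional x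

variable {C : ProperOpenCone V}

/-- The set `D`. -/
def CrossSection.carrier (D : CrossSection C) : Set V := {x | x ∈ C.carrier ∧ D.functional x = 1}

/-- The (relative) boundary `∂D` of `D`; `D` is relatively open. -/
def CrossSection.boundary (D : CrossSection C) : Set V := closure D.carrier \ D.carrier

/-- The Funk metric on the cross section. -/
def CrossSection.funk (D : CrossSection C) (x y : D.carrier) : ℝ := C.funk x y

theorem CrossSection.functional_pos [Nontrivial V] (D : CrossSection C) (y : C.carrier) :
    0 < D.functional y :=
  D.pos y (subset_closure y.2) (C.ne_zero_of_mem y.2)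

/-- The point of `D` on the ray through `y`. -/
def CrossSection.proj [Nontrivial V] (D : CrossSection C) (y : C.carrier) : D.carrier :=
  ⟨(D.functional y)⁻¹ • (y : V), C.smul_mem' (inv_pos.mpr (D.functional_pos y)) y.2, by
    rw [map_smul, smul_eq_mul, inv_mul_cancel₀ (D.functional_pos y).ne']⟩

/-- The extension to the cone of a function `f` of the Funk geometry of `D`, by the homogeneity
`f (t y) = f y + log t` of the Funk metric. The base-point of `D` is `D.proj b`, and the constant
is such that a function that vanishes there has an extension that vanishes at `b`. -/
def CrossSection.extend [Nontrivial V] (D : CrossSection C) (b : C.carrier)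
    (f : D.carrier → ℝ) : C.carrier → ℝ :=
  fun y => f (D.proj y) + Real.log (D.functional y / D.functional b)

/-- `A(x)`: the horofunctions of the Funk geometry on `D` that are limits of a sequence in `D`
converging to `x` in the usual topology. -/
def CrossSection.A [Nontrivial V] (D : CrossSection C) (b : C.carrier) (x : V) :
    Set (D.carrier → ℝ) :=
  {f | f ∈ horofunctionBoundary D.funk (D.proj b) ∧ ∃ z : ℕ → D.carrier,
    Tendsto (fun n => (z n : V)) atTop (𝓝 x) ∧ HoroConverges D.funk (D.proj b) atTop z f}

/-- `B(x)`: the Busemann points of the Funk geometry on `D` that are limits of a sequence in `D`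
converging to `x` in the usual topology. -/
def CrossSection.B [Nontrivial V] (D : CrossSection C) (b : C.carrier) (x : V) :
    Set (D.carrier → ℝ) :=
  {f | f ∈ busemannPoints D.funk (D.proj b) ∧ ∃ z : ℕ → D.carrier,
    Tendsto (fun n => (z n : V)) atTop (𝓝 x) ∧ HoroConverges D.funk (D.proj b) atTop z f}

end Cone

end

end ThompsonHoro

/-! Everything rests on `thompson_sub`: for `z` in the cone, `d_T(·, z) - d_T(b, z)` is already a
bracket, of `r_z` and `f_{C,z}`, with `c = F(z, b) - F(b, z)`. Both functions depend only on the ray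
of `z`, while `c` moves freely along that ray.

Along an ultrafilter, compactness makes the ray converge to some `x` in the closure of `D`,
`f_{C,z}` to the extension of a limit `f` of the Funk geometry, and `c` in the extended reals, so
every limit is a bracket. If `x ∈ D` and `c` is finite, it is the function of a multiple of `x`;
infinite `c` gives `r_x` or `f_{C,x}`. If `x ∈ ∂D`, then `f ∈ A(x)`. Conversely, rescaling points
that tend to `x` realises any `c` (`exists_seq_tendsto_bracket`). The resulting brackets come from
no point of the cone because they are unbounded below: scaling makes `f` small, and translation by
`x` then makes `r_x` small without changing `f` (`limit_translate`).

Busemann points are recognised by their defect: a limit `ξ` not coming from a point is Busemann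
exactly when `d(b, z) + ξ(z)` becomes arbitrarily small along some `z` converging to it. For a
bracket the defect is bounded by one Funk defect for `f` and one for `r_x`; `exists_seq_of_mem_B`
makes both small at once. Conversely, if a bracket with `c < ∞` is Busemann, scaling up by `e^n`
recovers `f` from it, and the Thompson defect controls the Funk defect of `f`
(`mem_B_of_bracket_mem`). For `c = ∞` the bracket is `r_x` whatever `f` is, so it suffices that
`B(x)` is non-empty (`B_nonempty`). -/

namespace ThompsonHoro

/-! ### Horofunctions and Busemann points of abstract proper distances. -/

section ProperDistance

variable {X : Type*} {d : X → X → ℝ}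

/-- A non-negative, possibly asymmetric distance whose bounded sets are totally bounded, and such
that points that stay within bounded distance of a base-point accumulate, in the horofunction
compactification, at points of the space. -/
structure IsProperDist (d : X → X → ℝ) : Prop where
  nonneg : ∀ x y, 0 ≤ d x y
  self : ∀ x, d x x = 0
  triangle : ∀ x y z, d x z ≤ d x y + d y z
  totallyBounded : ∀ (b : X) (R ε : ℝ), 0 < ε →
    ∃ S : Finset X, ∀ x, d x b + d b x ≤ R → ∃ y ∈ S, d x y + d y x < ε
  proper : ∀ (b : X) (R : ℝ) (u : Ultrafilter X), (∀ᶠ z in (u : Filter X), d b z ≤ R) →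
    ∃ z₀, ∀ y, Tendsto (fun z => d y z - d b z) u (𝓝 (d y z₀ - d b z₀))

namespace IsProperDist

variable {b : X} {ι : Type*} {l : Filter ι} {z : ι → X} {ξ : X → ℝ}

theorem abs_sub_le (h : IsProperDist d) (y y' z : X) :
    |(d y z - d b z) - (d y' z - d b z)| ≤ d y y' + d y' y := by
  have h1 := h.triangle y y' z
  have h2 := h.triangle y' y z
  have h3 := h.nonneg y y'
  have h4 := h.nonneg y' y
  rw [abs_le]
  constructor <;> linarith

theorem limit_sub_le (h : IsProperDist d) [l.NeBot]
    (hz : ∀ y, Tendsto (fun i => d y (z i) - d b (z i)) l (𝓝 (ξ y))) (y y' : X) :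
    ξ y - ξ y' ≤ d y y' := by
  refine le_of_tendsto ((hz y).sub (hz y')) (Eventually.of_forall fun i => ?_)
  have h1 := h.triangle y y' (z i)
  linarith

theorem limit_base [l.NeBot]
    (hz : ∀ y, Tendsto (fun i => d y (z i) - d b (z i)) l (𝓝 (ξ y))) : ξ b = 0 := by
  refine tendsto_nhds_unique (hz b) ?_
  simp

/-- The functions `d · z - d b z` are uniformly Lipschitz for the symmetrised distance, so on a
totally bounded ball convergence on a finite net suffices. This reduces the topology of the boundary
to pointwise convergence. -/
theorem eventually_ball (h : IsProperDist d) [l.NeBot]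
    (hz : ∀ y, Tendsto (fun i => d y (z i) - d b (z i)) l (𝓝 (ξ y))) (R : ℝ) {ε : ℝ}
    (hε : 0 < ε) :
    ∀ᶠ i in l, ∀ y, d y b + d b y ≤ R → |ξ y - (d y (z i) - d b (z i))| < ε := by
  obtain ⟨S, hS⟩ := h.totallyBounded b R (ε / 3) (by positivity)
  have hev : ∀ᶠ i in l, ∀ y ∈ S, |ξ y - (d y (z i) - d b (z i))| < ε / 3 := by
    rw [Filter.eventually_all_finset]
    intro y _
    filter_upwards [(Metric.tendsto_nhds.mp (hz y)) (ε / 3) (by positivity)] with i hi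
    rwa [Real.dist_eq, abs_sub_comm] at hi
  filter_upwards [hev] with i hi y hy
  obtain ⟨y', hy', hyy'⟩ := hS y hy
  have h1 := abs_lt.mp (hi y' hy')
  have h2 := abs_le.mp (h.abs_sub_le (b := b) y y' (z i))
  have h3 := h.limit_sub_le hz y y'
  have h4 := h.limit_sub_le hz y' y
  have h5 := h.nonneg y y'
  have h6 := h.nonneg y' y
  rw [abs_lt]
  constructor <;> linarith [h1.1, h1.2, h2.1, h2.2]

theorem horoConverges_iff (h : IsProperDist d) [l.NeBot] :
    HoroConverges d b l z ξ ↔ ∀ y, Tendsto (fun i => d y (z i) - d b (z i)) l (𝓝 (ξ y)) := by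
  unfold HoroConverges
  rw [UniformOnFun.tendsto_iff_tendstoUniformlyOn]
  constructor
  · intro H y
    refine (H {y} ⟨d y y + d y y, ?_⟩).tendsto_at (mem_singleton y)
    rintro x rfl y rfl
    exact le_rfl
  · rintro H S ⟨R, hR⟩
    rw [Metric.tendstoUniformlyOn_iff]
    intro ε hε
    rcases S.eq_empty_or_nonempty with rfl | ⟨x₀, hx₀⟩
    · simp
    filter_upwards [h.eventually_ball H (R + (d x₀ b + d b x₀)) hε] with i hi y hy
    refine hi y ?_
    have h1 := hR y hy x₀ hx₀
    have h2 := h.triangle y x₀ b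
    have h3 := h.triangle b x₀ y
    linarith

/-- Uniform convergence on the countably many balls of integer radius is enough, so a limit along
any filter is also a limit along a sequence, which can be made to meet the conditions `P n` on the
way. -/
theorem exists_seq (h : IsProperDist d) [l.NeBot]
    (hz : ∀ y, Tendsto (fun i => d y (z i) - d b (z i)) l (𝓝 (ξ y))) {P : ℕ → ι → Prop}
    (hP : ∀ n, ∀ᶠ i in l, P n i) :
    ∃ s : ℕ → ι, (∀ n, P n (s n)) ∧
      ∀ y, Tendsto (fun n => d y (z (s n)) - d b (z (s n))) atTop (𝓝 (ξ y)) := by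
  have hex : ∀ n : ℕ, ∃ i, P n i ∧
      ∀ y, d y b + d b y ≤ n → |ξ y - (d y (z i) - d b (z i))| < 1 / ((n : ℝ) + 1) :=
    fun n => ((hP n).and (h.eventually_ball hz n (by positivity))).exists
  choose s hs hs' using hex
  refine ⟨s, hs, fun y => ?_⟩
  rw [tendsto_iff_dist_tendsto_zero]
  refine squeeze_zero' (Eventually.of_forall fun n => dist_nonneg) ?_
    tendsto_one_div_add_atTop_nhds_zero_nat
  filter_upwards [eventually_ge_atTop ⌈d y b + d b y⌉₊] with n hn
  rw [dist_comm, Real.dist_eq]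
  exact (hs' n y (Nat.ceil_le.mp hn)).le

theorem exists_ultrafilter_limit (h : IsProperDist d) (b : X) (u : Ultrafilter ι) (z : ι → X) :
    ∃ ξ : X → ℝ, ∀ y, Tendsto (fun i => d y (z i) - d b (z i)) u (𝓝 (ξ y)) := by
  have hex : ∀ y, ∃ c : ℝ, Tendsto (fun i => d y (z i) - d b (z i)) u (𝓝 c) := by
    intro y
    have hK : IsCompact (Icc (-d b y) (d y b)) := isCompact_Icc
    obtain ⟨c, -, hc⟩ := hK.ultrafilter_le_nhds (u.map fun i => d y (z i) - d b (z i)) (by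
      rw [le_principal_iff]
      refine Filter.Eventually.of_forall (f := (u : Filter ι)) fun i => ?_
      have h1 := h.triangle y b (z i)
      have h2 := h.triangle b y (z i)
      constructor <;> linarith)
    exact ⟨c, hc⟩
  choose ξ hξ using hex
  exact ⟨ξ, hξ⟩

theorem mem_closure_iff (h : IsProperDist d) :
    UniformOnFun.ofFun (symBounded d) ξ ∈ closure (range (horoMap d b)) ↔
      ∃ u : Ultrafilter X, ∀ y, Tendsto (fun z => d y z - d b z) u (𝓝 (ξ y)) := by
  constructor
  · intro H
    have hne : (comap (horoMap d b) (𝓝 (UniformOnFun.ofFun (symBounded d) ξ))).NeBot := by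
      rw [comap_neBot_iff_frequently]
      exact (mem_closure_iff_frequently.mp H).mono fun x hx => hx
    refine ⟨Ultrafilter.of (comap (horoMap d b) (𝓝 (UniformOnFun.ofFun (symBounded d) ξ))), ?_⟩
    exact h.horoConverges_iff.mp (tendsto_comap.mono_left (Ultrafilter.of_le _))
  · rintro ⟨u, hu⟩
    have hu' : HoroConverges d b (u : Filter X) id ξ := h.horoConverges_iff.mpr hu
    exact mem_closure_of_tendsto hu' (Eventually.of_forall fun z => mem_range_self z)

theorem mem_range_iff :
    UniformOnFun.ofFun (symBounded d) ξ ∈ range (horoMap d b) ↔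
      ∃ z, ∀ y, ξ y = d y z - d b z := by
  constructor
  · rintro ⟨z, hz⟩
    exact ⟨z, fun y => (congrFun hz y).symm⟩
  · rintro ⟨z, hz⟩
    exact ⟨z, congrArg (UniformOnFun.ofFun (symBounded d)) (funext fun y => (hz y).symm)⟩

theorem mem_horofunctionBoundary_iff (h : IsProperDist d) :
    ξ ∈ horofunctionBoundary d b ↔
      (∃ u : Ultrafilter X, ∀ y, Tendsto (fun z => d y z - d b z) u (𝓝 (ξ y))) ∧
        ¬ ∃ z, ∀ y, ξ y = d y z - d b z := by
  rw [← h.mem_closure_iff, ← mem_range_iff]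
  rfl

theorem mem_horofunctionBoundary_of_tendsto (h : IsProperDist d) [l.NeBot]
    (hz : ∀ y, Tendsto (fun i => d y (z i) - d b (z i)) l (𝓝 (ξ y)))
    (hξ : ¬ ∃ z, ∀ y, ξ y = d y z - d b z) : ξ ∈ horofunctionBoundary d b := by
  refine h.mem_horofunctionBoundary_iff.mpr ⟨⟨(Ultrafilter.of l).map z, fun y => ?_⟩, hξ⟩
  rw [Ultrafilter.coe_map, tendsto_map'_iff]
  exact (hz y).mono_left (Ultrafilter.of_le l)

/-- Otherwise some ultrafilter finer than `l` stays in a bounded region, where properness identifies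
its limit with the function of a point. -/
theorem tendsto_dist_atTop (h : IsProperDist d) [l.NeBot]
    (hz : ∀ y, Tendsto (fun i => d y (z i) - d b (z i)) l (𝓝 (ξ y)))
    (hξ : ¬ ∃ z, ∀ y, ξ y = d y z - d b z) : Tendsto (fun i => d b (z i)) l atTop := by
  rw [tendsto_atTop]
  by_contra! hR
  obtain ⟨R, hR⟩ := hR
  have hf : ∃ᶠ i in l, d b (z i) ≤ R := hR.mono fun i hi => le_of_lt hi
  have hne : (l ⊓ 𝓟 {i | d b (z i) ≤ R}).NeBot := frequently_mem_iff_neBot.mp hf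
  set v := Ultrafilter.of (l ⊓ 𝓟 {i | d b (z i) ≤ R})
  have hv := Ultrafilter.of_le (l ⊓ 𝓟 {i | d b (z i) ≤ R})
  obtain ⟨z₀, hz₀⟩ := h.proper b R (v.map z) (by
    rw [Ultrafilter.coe_map, eventually_map]
    exact hv (mem_inf_of_right (mem_principal_self _)))
  refine hξ ⟨z₀, fun y => ?_⟩
  refine tendsto_nhds_unique (f := fun i => d y (z i) - d b (z i)) (l := (v : Filter ι)) ?_ ?_
  · exact (hz y).mono_left (hv.trans inf_le_left)
  · have := hz₀ y
    rwa [Ultrafilter.coe_map, tendsto_map'_iff] at this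

end IsProperDist

end ProperDistance

theorem exists_strictMono_rel {r : ℕ → ℕ → Prop} (hr : ∀ m, ∀ᶠ n in atTop, r m n) :
    ∃ φ : ℕ → ℕ, StrictMono φ ∧ ∀ i k, i < k → r (φ i) (φ k) := by
  simp only [eventually_atTop] at hr
  choose N hN using hr
  let φ : ℕ → ℕ := fun k => (fun n => max (n + 1) (N n))^[k] 0
  have hφ : ∀ k, φ (k + 1) = max (φ k + 1) (N (φ k)) := fun k =>
    Function.iterate_succ_apply' _ _ _
  have hmono : StrictMono φ := strictMono_nat_of_lt_succ fun k => by
    rw [hφ]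
    exact lt_of_lt_of_le (Nat.lt_succ_self _) (le_max_left _ _)
  refine ⟨φ, hmono, fun i k hik => hN _ _ ?_⟩
  calc N (φ i) ≤ φ (i + 1) := by rw [hφ]; exact le_max_right _ _
    _ ≤ φ k := hmono.monotone hik

namespace IsProperDist

variable {X : Type*} {d : X → X → ℝ} {b : X} {ξ : X → ℝ}

/-- Letting `t` tend to `sup T` in the almost-geodesic condition bounds `d (γ 0) (γ s) + ξ (γ s) - ξ
(γ 0)`; convergence at `γ 0` then changes the base-point to `b`. -/
theorem eventually_of_mem_busemannPoints (h : IsProperDist d) (hξ : ξ ∈ busemannPoints d b) :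
    ∃ l : Filter X, l.NeBot ∧ (∀ y, Tendsto (fun z => d y z - d b z) l (𝓝 (ξ y))) ∧
      ∀ ε : ℝ, 0 < ε → ∀ᶠ z in l, d b z + ξ z < ε := by
  obtain ⟨-, T, γ, hγ, hconv⟩ := hξ
  have : Nonempty T := ⟨⟨0, hγ.zero_mem⟩⟩
  have hz := h.horoConverges_iff.mp hconv
  refine ⟨map (fun t : T => γ t) atTop, inferInstance, fun y => ?_, fun ε hε => ?_⟩
  · rw [tendsto_map'_iff]
    exact hz y
  rw [eventually_map]
  obtain ⟨N, hNT, hN⟩ := hγ.almost (ε / 4) (by positivity)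
  have hev := (Metric.tendsto_nhds.mp (hz (γ 0))) (ε / 4) (by positivity)
  filter_upwards [eventually_ge_atTop (⟨N, hNT⟩ : T), hev] with s hs hs'
  have hlim : ξ (γ s) - ξ (γ 0) ≤ 2 * (ε / 4) - d (γ 0) (γ s) := by
    refine le_of_tendsto ((hz (γ s)).sub (hz (γ 0))) ?_
    filter_upwards [eventually_ge_atTop s] with t ht
    have h1 := abs_lt.mp (hN s s.2 t t.2 hs ht)
    -- The case `s = t` says that the parameter `t` is nearly `d (γ 0) (γ t)`.
    have h2 := abs_lt.mp (hN t t.2 t t.2 (le_trans hs ht) le_rfl)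
    rw [h.self] at h2
    linarith [h1.1, h1.2, h2.1, h2.2]
  rw [Real.dist_eq, abs_lt] at hs'
  linarith [hs'.1, hs'.2]

/-- For fixed `m`, `d (z m) (z n) - d b (z n)` tends to `ξ (z m)`, so a small defect at `z m` makes
the triangle inequality through `z m` nearly an equality for large `n`. A subsequence with this for
all pairs, parametrised by distance to `b`, is an almost-geodesic. -/
theorem mem_busemannPoints_of_seq (h : IsProperDist d) (hξ : ¬ ∃ z, ∀ y, ξ y = d y z - d b z)
    {z : ℕ → X} (hz : ∀ y, Tendsto (fun n => d y (z n) - d b (z n)) atTop (𝓝 (ξ y)))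
    (hbus : ∀ n, d b (z n) + ξ (z n) < 1 / ((n : ℝ) + 1)) : ξ ∈ busemannPoints d b := by
  have htop := h.tendsto_dist_atTop hz hξ
  obtain ⟨n₀, hn₀⟩ := eventually_atTop.mp (htop.eventually_gt_atTop 0)
  obtain ⟨φ, hφ, hrel⟩ := exists_strictMono_rel (r := fun m n => n₀ ≤ n ∧ d b (z m) < d b (z n) ∧
      d b (z m) + d (z m) (z n) - d b (z n) < 1 / ((m : ℝ) + 1)) (by
    intro m
    refine (eventually_ge_atTop n₀).and ((htop.eventually_gt_atTop _).and ?_)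
    filter_upwards [(hz (z m)).eventually_lt_const
      (lt_sub_iff_add_lt'.mpr (hbus m))] with n hn
    linarith)
  -- The shift by one puts the indices beyond `n₀`, so every parameter is positive and `0` remains
  -- free for the base-point.
  let τ : ℕ → ℝ := fun k => d b (z (φ (k + 1)))
  have hτ : StrictMono τ := fun i k hik => (hrel (i + 1) (k + 1) (by omega)).2.1
  have hτpos : ∀ k, 0 < τ k := fun k => hn₀ _ (hrel 0 (k + 1) (by omega)).1
  let γ : ℝ → X := Function.extend τ (fun k => z (φ (k + 1))) (fun _ => b)
  have hγτ : ∀ k, γ (τ k) = z (φ (k + 1)) := fun k => hτ.injective.extend_apply _ _ k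
  have hγ0 : γ 0 = b := Function.extend_apply' _ _ _ (by
    rintro ⟨k, hk⟩
    exact (hτpos k).ne' hk)
  have hmem : ∀ k, τ k ∈ insert 0 (range τ) := fun k => mem_insert_of_mem _ (mem_range_self k)
  have hge : ∀ K, ∀ s ∈ insert 0 (range τ), τ K ≤ s → ∃ k, K ≤ k ∧ s = τ k := by
    rintro K s (rfl | ⟨k, rfl⟩) hs
    · exact absurd hs (not_le.mpr (hτpos K))
    · exact ⟨k, hτ.le_iff_le.mp hs, rfl⟩
  have hT : Nonempty (insert 0 (range τ) : Set ℝ) := ⟨⟨0, mem_insert _ _⟩⟩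
  refine ⟨h.mem_horofunctionBoundary_of_tendsto hz hξ, insert 0 (range τ), γ,
    ⟨?_, mem_insert _ _, ?_, ?_⟩, ?_⟩
  · rintro t (rfl | ⟨k, rfl⟩)
    exacts [le_rfl, (hτpos k).le]
  · rintro t (rfl | ⟨k, rfl⟩)
    exacts [⟨τ 0, hmem 0, hτpos 0⟩, ⟨τ (k + 1), hmem _, hτ (Nat.lt_succ_self k)⟩]
  · intro ε hε
    obtain ⟨K, hK⟩ := exists_nat_one_div_lt hε
    refine ⟨τ K, hmem K, fun s hs t ht hKs hst => ?_⟩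
    obtain ⟨k, hKk, rfl⟩ := hge K s hs hKs
    obtain ⟨j, hkj, rfl⟩ := hge k t ht hst
    rw [hγ0, hγτ, hγτ]
    rcases hkj.eq_or_lt with rfl | hlt
    · simpa [τ, h.self] using hε
    have h1 := (hrel (k + 1) (j + 1) (by omega)).2.2
    have h2 := h.triangle b (z (φ (k + 1))) (z (φ (j + 1)))
    have h3 : (1 : ℝ) / ((φ (k + 1) : ℝ) + 1) ≤ 1 / ((K : ℝ) + 1) := by
      have : K ≤ φ (k + 1) := by
        have := hφ.id_le (k + 1)
        simp only [id] at this
        omega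
      have : (K : ℝ) ≤ φ (k + 1) := by exact_mod_cast this
      gcongr
    rw [abs_lt]
    constructor <;> simp only [τ] <;> linarith
  · rw [h.horoConverges_iff]
    intro y
    rw [Metric.tendsto_atTop]
    intro ε hε
    obtain ⟨K, hK⟩ := Metric.tendsto_atTop.mp (hz y) ε hε
    refine ⟨⟨τ K, hmem K⟩, fun t ht => ?_⟩
    obtain ⟨k, hKk, hk⟩ := hge K t t.2 ht
    rw [hk, hγτ]
    refine hK _ ?_
    have := hφ.id_le (k + 1)
    simp only [id] at this
    omega

theorem mem_busemannPoints_of_eventually (h : IsProperDist d) {ι : Type*} {l : Filter ι} [l.NeBot]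
    {z : ι → X} (hξ : ¬ ∃ z, ∀ y, ξ y = d y z - d b z)
    (hz : ∀ y, Tendsto (fun i => d y (z i) - d b (z i)) l (𝓝 (ξ y)))
    (hbus : ∀ ε : ℝ, 0 < ε → ∀ᶠ i in l, d b (z i) + ξ (z i) < ε) : ξ ∈ busemannPoints d b := by
  obtain ⟨s, hs, hs'⟩ := h.exists_seq hz
    (P := fun n i => d b (z i) + ξ (z i) < 1 / ((n : ℝ) + 1))
    (fun n => hbus _ (by positivity))
  exact h.mem_busemannPoints_of_seq hξ hs' hs

end IsProperDist

end ThompsonHoro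

/-! ### The gauge and the Funk metric of a proper open cone. -/

namespace ThompsonHoro

namespace ProperOpenCone

variable {V : Type*} [NormedAddCommGroup V] [NormedSpace ℝ V] (C : ProperOpenCone V)

section ClosedCone

variable {x y : V}

theorem smul_mem {t : ℝ} (ht : 0 < t) (hx : x ∈ C.carrier) : t • x ∈ C.carrier :=
  C.smul_mem' ht hx

theorem zero_mem_closure : (0 : V) ∈ closure C.carrier := by
  have h : (0 : V) ∈ closure C.carrier ∩ -closure C.carrier := by
    rw [C.proper]
    rfl
  exact h.1

theorem add_mem_closure (hx : x ∈ closure C.carrier) (hy : y ∈ closure C.carrier) :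
    x + y ∈ closure C.carrier :=
  map_mem_closure₂ continuous_add hx hy fun _ ha _ hb => C.add_mem' ha hb

theorem smul_mem_closure {t : ℝ} (ht : 0 ≤ t) (hx : x ∈ closure C.carrier) :
    t • x ∈ closure C.carrier := by
  rcases ht.eq_or_lt with rfl | ht
  · rw [zero_smul]
    exact C.zero_mem_closure
  · exact map_mem_closure (continuous_const_smul t) hx fun _ ha => C.smul_mem' ht ha

theorem closure_add_mem (hx : x ∈ closure C.carrier) (hy : y ∈ C.carrier) :
    x + y ∈ C.carrier := by
  have hnhds : (fun x' => x + y - x') ⁻¹' C.carrier ∈ 𝓝 x := by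
    refine (continuous_const.sub continuous_id).continuousAt.preimage_mem_nhds ?_
    refine C.isOpen.mem_nhds ?_
    simpa using hy
  obtain ⟨x', hx', hx'C⟩ := mem_closure_iff_nhds.mp hx _ hnhds
  have h := C.add_mem' hx' hx'C
  simpa using h

theorem eq_zero_of_neg_mem_closure (hx : x ∈ closure C.carrier) (hx' : -x ∈ closure C.carrier) :
    x = 0 := by
  have h : x ∈ closure C.carrier ∩ -closure C.carrier := ⟨hx, hx'⟩
  rwa [C.proper] at h

theorem mem_of_sub_smul_mem_closure {t : ℝ} (ht : 0 < t) (hy : y ∈ C.carrier)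
    (h : x - t • y ∈ closure C.carrier) : x ∈ C.carrier := by
  have h' := C.closure_add_mem h (C.smul_mem ht hy)
  simpa using h'

end ClosedCone

section Gauge

variable {x y z : V}

/-- The infimum is attained because the closed cone is closed; the value `0` would put `-x` in the
closed cone, against properness. -/
theorem gauge_spec (hx : x ∈ closure C.carrier) (hx0 : x ≠ 0) (hy : y ∈ C.carrier) :
    0 < C.gauge x y ∧ C.gauge x y • y - x ∈ closure C.carrier := by
  set S := {t : ℝ | 0 < t ∧ C.le x (t • y)} with hS
  have hlow : BddBelow S := ⟨0, fun t ht => ht.1.le⟩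
  have hne : S.Nonempty := by
    have hc : Tendsto (fun t : ℝ => y - t • x) (𝓝[>] 0) (𝓝 (y - (0 : ℝ) • x)) :=
      (Continuous.tendsto (by fun_prop) 0).mono_left nhdsWithin_le_nhds
    rw [zero_smul, sub_zero] at hc
    obtain ⟨t, htC, ht⟩ :=
      ((hc.eventually (C.isOpen.mem_nhds hy)).and self_mem_nhdsWithin).exists
    refine ⟨t⁻¹, inv_pos.mpr (mem_Ioi.mp ht), ?_⟩
    have h := C.smul_mem (inv_pos.mpr (mem_Ioi.mp ht)) htC
    rw [smul_sub, inv_smul_smul₀ (ne_of_gt (mem_Ioi.mp ht))] at h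
    exact subset_closure h
  have hclosed : IsClosed {t : ℝ | t • y - x ∈ closure C.carrier} :=
    isClosed_closure.preimage (by fun_prop)
  have hmem : sInf S • y - x ∈ closure C.carrier :=
    closure_minimal (fun t ht => ht.2) hclosed (csInf_mem_closure hne hlow)
  refine ⟨?_, hmem⟩
  have h0 : 0 ≤ sInf S := le_csInf hne fun t ht => ht.1.le
  refine lt_of_le_of_ne h0 fun h => hx0 ?_
  have h : 0 = sInf S := h
  rw [← h, zero_smul, zero_sub] at hmem
  exact C.eq_zero_of_neg_mem_closure hx hmem

theorem gauge_pos (hx : x ∈ closure C.carrier) (hx0 : x ≠ 0) (hy : y ∈ C.carrier) :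
    0 < C.gauge x y := (C.gauge_spec hx hx0 hy).1

/-- Valid for every real `t`, since `t ≤ 0` fails on both sides; this turns gauge inequalities into
membership in the closed cone. -/
theorem gauge_le_iff (hx : x ∈ closure C.carrier) (hx0 : x ≠ 0) (hy : y ∈ C.carrier) {t : ℝ} :
    C.gauge x y ≤ t ↔ t • y - x ∈ closure C.carrier := by
  constructor
  · intro h
    have h1 := C.add_mem_closure (C.gauge_spec hx hx0 hy).2
      (C.smul_mem_closure (sub_nonneg.mpr h) (subset_closure hy))
    convert h1 using 1
    module
  · intro h
    refine csInf_le ⟨0, fun t ht => ht.1.le⟩ ⟨?_, h⟩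
    by_contra! ht
    have h1 := C.add_mem_closure h (C.smul_mem_closure (neg_nonneg.mpr ht) (subset_closure hy))
    refine hx0 (C.eq_zero_of_neg_mem_closure hx ?_)
    convert h1 using 1
    module

theorem gauge_mul_le (hx : x ∈ closure C.carrier) (hx0 : x ≠ 0) (hy : y ∈ C.carrier)
    (hy0 : y ≠ 0) (hz : z ∈ C.carrier) : C.gauge x z ≤ C.gauge x y * C.gauge y z := by
  rw [C.gauge_le_iff hx hx0 hz]
  have h1 := C.smul_mem_closure (C.gauge_pos hx hx0 hy).le
    (C.gauge_spec (subset_closure hy) hy0 hz).2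
  convert C.add_mem_closure h1 (C.gauge_spec hx hx0 hy).2 using 1
  module

theorem gauge_smul_left {s : ℝ} (hs : 0 < s) (hx : x ∈ closure C.carrier) (hx0 : x ≠ 0)
    (hy : y ∈ C.carrier) : C.gauge (s • x) y = s * C.gauge x y := by
  have key : ∀ t, C.gauge (s • x) y ≤ t ↔ s * C.gauge x y ≤ t := by
    intro t
    rw [C.gauge_le_iff (C.smul_mem_closure hs.le hx) (smul_ne_zero hs.ne' hx0) hy,
      ← le_div_iff₀' hs, C.gauge_le_iff hx hx0 hy]
    constructor
    · intro h
      convert C.smul_mem_closure (inv_pos.mpr hs).le h using 1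
      rw [smul_sub, inv_smul_smul₀ hs.ne', smul_smul, div_eq_inv_mul]
    · intro h
      convert C.smul_mem_closure hs.le h using 1
      rw [smul_sub, smul_smul, mul_div_cancel₀ _ hs.ne']
  exact le_antisymm ((key _).mpr le_rfl) ((key _).mp le_rfl)

theorem gauge_smul_right {s : ℝ} (hs : 0 < s) (hx : x ∈ closure C.carrier) (hx0 : x ≠ 0)
    (hy : y ∈ C.carrier) : C.gauge x (s • y) = s⁻¹ * C.gauge x y := by
  have key : ∀ t, C.gauge x (s • y) ≤ t ↔ s⁻¹ * C.gauge x y ≤ t := by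
    intro t
    rw [C.gauge_le_iff hx hx0 (C.smul_mem hs hy), inv_mul_le_iff₀ hs,
      C.gauge_le_iff hx hx0 hy, smul_smul, mul_comm]
  exact le_antisymm ((key _).mpr le_rfl) ((key _).mp le_rfl)

theorem gauge_add_smul {a : ℝ} (ha : 0 ≤ a) (hx : x ∈ closure C.carrier) (hx0 : x ≠ 0)
    (hy : y ∈ C.carrier) : C.gauge (x + a • y) y = C.gauge x y + a := by
  have hmem := C.add_mem_closure hx (C.smul_mem_closure ha (subset_closure hy))
  have hne : x + a • y ≠ 0 := fun h => hx0 (C.eq_zero_of_neg_mem_closure hx (by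
    rw [← eq_neg_of_add_eq_zero_right h]
    exact C.smul_mem_closure ha (subset_closure hy)))
  have key : ∀ t, C.gauge (x + a • y) y ≤ t ↔ C.gauge x y + a ≤ t := by
    intro t
    rw [C.gauge_le_iff hmem hne hy, ← le_sub_iff_add_le, C.gauge_le_iff hx hx0 hy]
    refine iff_of_eq (congrArg (· ∈ closure C.carrier) ?_)
    module
  exact le_antisymm ((key _).mpr le_rfl) ((key _).mp le_rfl)

theorem gauge_self (hx : x ∈ C.carrier) (hx0 : x ≠ 0) : C.gauge x x = 1 := by
  refine le_antisymm ?_ ?_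
  · rw [C.gauge_le_iff (subset_closure hx) hx0 hx, one_smul, sub_self]
    exact C.zero_mem_closure
  · by_contra! h
    have h1 := (C.gauge_le_iff (subset_closure hx) hx0 hx (t := C.gauge x x)).mp le_rfl
    have h2 := C.smul_mem_closure (inv_pos.mpr (sub_pos.mpr h)).le h1
    refine hx0 (C.eq_zero_of_neg_mem_closure (subset_closure hx) ?_)
    convert h2 using 1
    have h3 : (C.gauge x x) • x - x = (-(1 - C.gauge x x)) • x := by module
    rw [h3, smul_smul, mul_neg, inv_mul_cancel₀ (sub_pos.mpr h).ne', neg_one_smul]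

theorem gauge_mono_right (hx : x ∈ closure C.carrier) (hx0 : x ≠ 0) (hy : y ∈ C.carrier)
    (hz : z ∈ C.carrier) (hyz : z - y ∈ closure C.carrier) : C.gauge x z ≤ C.gauge x y := by
  rw [C.gauge_le_iff hx hx0 hz]
  have h1 := C.smul_mem_closure (C.gauge_pos hx hx0 hy).le hyz
  convert C.add_mem_closure h1 (C.gauge_spec hx hx0 hy).2 using 1
  module

/-- As `y` is interior, `w i` and `x` eventually differ by at most `(ε / 2) • y` in the order of the
cone. The limit `x` may lie on the boundary. -/
theorem tendsto_gauge_left {ι : Type*} {l : Filter ι} {w : ι → V} (hx : x ∈ closure C.carrier)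
    (hx0 : x ≠ 0) (hy : y ∈ C.carrier) (hw : ∀ i, w i ∈ closure C.carrier) (hw0 : ∀ i, w i ≠ 0)
    (hlim : Tendsto w l (𝓝 x)) : Tendsto (fun i => C.gauge (w i) y) l (𝓝 (C.gauge x y)) := by
  rw [Metric.tendsto_nhds]
  intro ε hε
  have hε' : 0 < ε / 2 := by positivity
  have hmem := C.isOpen.mem_nhds (C.smul_mem hε' hy)
  have h1 : Tendsto (fun i => x + (ε / 2) • y - w i) l (𝓝 ((ε / 2) • y)) := by
    simpa using (tendsto_const_nhds (x := x + (ε / 2) • y)).sub hlim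
  have h2 : Tendsto (fun i => w i + (ε / 2) • y - x) l (𝓝 ((ε / 2) • y)) := by
    simpa using (hlim.add_const ((ε / 2) • y)).sub_const x
  filter_upwards [h1 hmem, h2 hmem] with i hi1 hi2
  have h3 : C.gauge (w i) y ≤ C.gauge x y + ε / 2 := by
    rw [C.gauge_le_iff (hw i) (hw0 i) hy]
    convert C.add_mem_closure (subset_closure hi1) (C.gauge_spec hx hx0 hy).2 using 1
    module
  have h4 : C.gauge x y ≤ C.gauge (w i) y + ε / 2 := by
    rw [C.gauge_le_iff hx hx0 hy]
    convert C.add_mem_closure (subset_closure hi2) (C.gauge_spec (hw i) (hw0 i) hy).2 using 1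
    module
  rw [Real.dist_eq, abs_lt]
  constructor <;> linarith

/-- If the points `w i` of the cone tend to a point of its boundary, then `M(y, w i)` tends to
infinity. -/
theorem tendsto_gauge_atTop {ι : Type*} {l : Filter ι} {w : ι → V} (hy : y ∈ C.carrier)
    (hy0 : y ≠ 0) (hx : x ∉ C.carrier) (hw : ∀ i, w i ∈ C.carrier) (hlim : Tendsto w l (𝓝 x)) :
    Tendsto (fun i => C.gauge y (w i)) l atTop := by
  rw [tendsto_atTop]
  intro R
  set R' := max R 1 with hR'
  have hpos : 0 < R' := lt_of_lt_of_le one_pos (le_max_right _ _)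
  -- A point that dominates a positive multiple of `y` is interior, which `x` is not; the failure
  -- persists near `x`.
  have hnot : x - R'⁻¹ • y ∉ closure C.carrier := fun h =>
    hx (C.mem_of_sub_smul_mem_closure (inv_pos.mpr hpos) hy h)
  have hev := (hlim.sub_const (R'⁻¹ • y)).eventually
    (isClosed_closure.isOpen_compl.mem_nhds hnot)
  filter_upwards [hev] with i hi
  refine (le_max_left R 1).trans ?_
  rw [← hR']
  by_contra! hlt
  refine hi ?_
  have h1 := (C.gauge_le_iff (subset_closure hy) hy0 (hw i)).mp hlt.le
  convert C.smul_mem_closure (inv_pos.mpr hpos).le h1 using 1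
  rw [smul_sub, inv_smul_smul₀ hpos.ne']

/-- Points of the cone close to `y` are comparable to it, with constants close to one. -/
theorem eventually_gauge_le (hy : y ∈ C.carrier) (hy0 : y ≠ 0) {ε : ℝ} (hε : 0 < ε) :
    ∀ᶠ z in 𝓝 y, z ∈ C.carrier ∧ (z ≠ 0 → C.gauge y z ≤ 1 + ε ∧ C.gauge z y ≤ 1 + ε) := by
  have hmem := C.isOpen.mem_nhds (C.smul_mem hε hy)
  have h1 : Tendsto (fun z => (1 + ε) • z - y) (𝓝 y) (𝓝 (ε • y)) := by
    have : Tendsto (fun z => (1 + ε) • z - y) (𝓝 y) (𝓝 ((1 + ε) • y - y)) :=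
      Continuous.tendsto (by fun_prop) y
    convert this using 2
    module
  have h2 : Tendsto (fun z => (1 + ε) • y - z) (𝓝 y) (𝓝 (ε • y)) := by
    have : Tendsto (fun z => (1 + ε) • y - z) (𝓝 y) (𝓝 ((1 + ε) • y - y)) :=
      Continuous.tendsto (by fun_prop) y
    convert this using 2
    module
  filter_upwards [C.isOpen.mem_nhds hy, h1 hmem, h2 hmem] with z hz hz1 hz2
  refine ⟨hz, fun hz0 => ⟨?_, ?_⟩⟩
  · exact (C.gauge_le_iff (subset_closure hy) hy0 hz).mpr (subset_closure hz1)
  · exact (C.gauge_le_iff (subset_closure hz) hz0 hy).mpr (subset_closure hz2)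

end Gauge

section Funk

variable {x y z : V}

theorem funk_smul_left {s : ℝ} (hs : 0 < s) (hx : x ∈ closure C.carrier) (hx0 : x ≠ 0)
    (hy : y ∈ C.carrier) : C.funk (s • x) y = C.funk x y + Real.log s := by
  rw [funk, C.gauge_smul_left hs hx hx0 hy,
    Real.log_mul hs.ne' (C.gauge_pos hx hx0 hy).ne', add_comm]
  rfl

theorem funk_smul_right {s : ℝ} (hs : 0 < s) (hx : x ∈ closure C.carrier) (hx0 : x ≠ 0)
    (hy : y ∈ C.carrier) : C.funk x (s • y) = C.funk x y - Real.log s := by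
  rw [funk, C.gauge_smul_right hs hx hx0 hy,
    Real.log_mul (inv_pos.mpr hs).ne' (C.gauge_pos hx hx0 hy).ne', Real.log_inv]
  unfold funk
  ring

theorem funk_le_iff (hx : x ∈ closure C.carrier) (hx0 : x ≠ 0) (hy : y ∈ C.carrier) {t : ℝ} :
    C.funk x y ≤ t ↔ Real.exp t • y - x ∈ closure C.carrier := by
  rw [← C.gauge_le_iff hx hx0 hy, funk, Real.log_le_iff_le_exp (C.gauge_pos hx hx0 hy)]

theorem tendsto_funk_left {ι : Type*} {l : Filter ι} {w : ι → V} (hx : x ∈ closure C.carrier)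
    (hx0 : x ≠ 0) (hy : y ∈ C.carrier) (hw : ∀ i, w i ∈ closure C.carrier) (hw0 : ∀ i, w i ≠ 0)
    (hlim : Tendsto w l (𝓝 x)) : Tendsto (fun i => C.funk (w i) y) l (𝓝 (C.funk x y)) :=
  (C.tendsto_gauge_left hx hx0 hy hw hw0 hlim).log (C.gauge_pos hx hx0 hy).ne'

variable [Nontrivial V]

theorem funk_triangle (hx : x ∈ closure C.carrier) (hx0 : x ≠ 0) (hy : y ∈ C.carrier)
    (hz : z ∈ C.carrier) : C.funk x z ≤ C.funk x y + C.funk y z := by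
  have hy0 := C.ne_zero_of_mem hy
  have h1 := C.gauge_pos hx hx0 hy
  have h2 := C.gauge_pos (subset_closure hy) hy0 hz
  unfold funk
  rw [← Real.log_mul h1.ne' h2.ne']
  exact Real.log_le_log (C.gauge_pos hx hx0 hz) (C.gauge_mul_le hx hx0 hy hy0 hz)

theorem funk_self (hx : x ∈ C.carrier) : C.funk x x = 0 := by
  rw [funk, C.gauge_self hx (C.ne_zero_of_mem hx), Real.log_one]

theorem eventually_funk_lt (hy : y ∈ C.carrier) {ε : ℝ} (hε : 0 < ε) :
    ∀ᶠ z in 𝓝 y, z ∈ C.carrier ∧ C.funk y z < ε ∧ C.funk z y < ε := by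
  have hy0 := C.ne_zero_of_mem hy
  have hε' : 0 < Real.exp (ε / 2) - 1 := by
    have := Real.one_lt_exp_iff.mpr (half_pos hε)
    linarith
  filter_upwards [C.eventually_gauge_le hy hy0 hε'] with z hz
  have hz0 := C.ne_zero_of_mem hz.1
  obtain ⟨h1, h2⟩ := hz.2 hz0
  have key : ∀ {r : ℝ}, 0 < r → r ≤ 1 + (Real.exp (ε / 2) - 1) → Real.log r < ε := by
    intro r hr h
    have h3 : Real.log r ≤ ε / 2 := (Real.log_le_iff_le_exp hr).mpr (by linarith)
    linarith
  exact ⟨hz.1, key (C.gauge_pos (subset_closure hy) hy0 hz.1) h1,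
    key (C.gauge_pos (subset_closure hz.1) hz0 hy) h2⟩

theorem tendsto_funk_right {ι : Type*} {l : Filter ι} {w : ι → V} (hx : x ∈ closure C.carrier)
    (hx0 : x ≠ 0) (hy : y ∈ C.carrier) (hlim : Tendsto w l (𝓝 y)) :
    Tendsto (fun i => C.funk x (w i)) l (𝓝 (C.funk x y)) := by
  rw [Metric.tendsto_nhds]
  intro ε hε
  filter_upwards [hlim.eventually (C.eventually_funk_lt hy hε)] with i hi
  have h1 := C.funk_triangle hx hx0 hy hi.1
  have h2 := C.funk_triangle hx hx0 hi.1 hy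
  rw [Real.dist_eq, abs_lt]
  constructor <;> linarith [hi.2.1, hi.2.2]

end Funk

end ProperOpenCone

end ThompsonHoro

/-! ### Compactness of slabs, and properness of the Funk and Thompson metrics. -/

namespace ThompsonHoro

theorem exists_tendsto_of_isCompact {X V : Type*} [TopologicalSpace V] {u : Ultrafilter X} {p : X → V}
    {Q : Set V}
    (hQ : IsCompact Q) (hu : ∀ᶠ z in (u : Filter X), p z ∈ Q) :
    ∃ z₀ ∈ Q, Tendsto p u (𝓝 z₀) := by
  obtain ⟨z₀, hz₀, h⟩ := hQ.ultrafilter_le_nhds (u.map p) (le_principal_iff.mpr hu)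
  exact ⟨z₀, hz₀, h⟩

variable {V : Type*} [NormedAddCommGroup V] [NormedSpace ℝ V] {C : ProperOpenCone V}

namespace CrossSection

section Compact

variable [FiniteDimensional ℝ V] (D : CrossSection C)

theorem continuous_functional : Continuous D.functional :=
  D.functional.continuous_of_finiteDimensional

theorem exists_norm_le : ∃ m : ℝ, 0 < m ∧ ∀ x ∈ closure C.carrier, m * ‖x‖ ≤ D.functional x := by
  have : ProperSpace V := FiniteDimensional.proper ℝ V
  have hK : IsCompact (closure C.carrier ∩ Metric.sphere (0 : V) 1) :=
    (isCompact_sphere 0 1).inter_left isClosed_closure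
  have hm : ∃ m : ℝ, 0 < m ∧
      ∀ x ∈ closure C.carrier ∩ Metric.sphere (0 : V) 1, m ≤ D.functional x := by
    rcases (closure C.carrier ∩ Metric.sphere (0 : V) 1).eq_empty_or_nonempty with h | h
    · exact ⟨1, one_pos, by simp [h]⟩
    · obtain ⟨x, hx, hmin⟩ := hK.exists_isMinOn h D.continuous_functional.continuousOn
      refine ⟨D.functional x, D.pos x hx.1 ?_, fun y hy => hmin hy⟩
      rintro rfl
      simpa using hx.2
  obtain ⟨m, hm0, hm⟩ := hm
  refine ⟨m, hm0, fun x hx => ?_⟩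
  rcases eq_or_ne x 0 with rfl | hx0
  · simp
  have hn : 0 < ‖x‖ := norm_pos_iff.mpr hx0
  have h := hm (‖x‖⁻¹ • x) ⟨C.smul_mem_closure (inv_pos.mpr hn).le hx, by
    simp [norm_smul, hn.ne']⟩
  rw [map_smul, smul_eq_mul, ← div_eq_inv_mul, le_div_iff₀ hn] at h
  exact h

theorem isCompact_slab (R : ℝ) :
    IsCompact {x : V | x ∈ closure C.carrier ∧ D.functional x ≤ R} := by
  have : ProperSpace V := FiniteDimensional.proper ℝ V
  refine Metric.isCompact_of_isClosed_isBounded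
    (isClosed_closure.inter (isClosed_le D.continuous_functional continuous_const)) ?_
  obtain ⟨m, hm0, hm⟩ := D.exists_norm_le
  refine (Metric.isBounded_closedBall (x := (0 : V)) (r := R / m)).subset ?_
  rintro x ⟨hx, hxR⟩
  rw [mem_closedBall_zero_iff, le_div_iff₀ hm0, mul_comm]
  exact (hm x hx).trans hxR

/-- The points of a slab of the cone that are bounded below by a point of the cone. -/
theorem isCompact_slab_above {b : V} (hb : b ∈ C.carrier) {η : ℝ} (hη : 0 < η) (R : ℝ) :
    IsCompact {x : V | x - η • b ∈ closure C.carrier ∧ D.functional x ≤ R} := by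
  refine (D.isCompact_slab R).of_isClosed_subset ?_ ?_
  · exact (isClosed_closure.preimage (by fun_prop)).inter
      (isClosed_le D.continuous_functional continuous_const)
  · rintro x ⟨hx, hxR⟩
    exact ⟨subset_closure (C.mem_of_sub_smul_mem_closure hη hb hx), hxR⟩

theorem functional_eq_one_of_mem_closure {x : V} (hx : x ∈ closure D.carrier) :
    D.functional x = 1 :=
  closure_minimal (fun _ hy => hy.2) (isClosed_eq D.continuous_functional continuous_const) hx

end Compact

theorem mem_closure_cone (D : CrossSection C) {x : V} (hx : x ∈ closure D.carrier) :
    x ∈ closure C.carrier := closure_mono (fun _ hy => hy.1) hx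

theorem ne_zero_of_mem_closure [FiniteDimensional ℝ V] (D : CrossSection C) {x : V}
    (hx : x ∈ closure D.carrier) : x ≠ 0 := by
  rintro rfl
  simpa using D.functional_eq_one_of_mem_closure hx

end CrossSection

theorem CrossSection.functional_le_gauge (D : CrossSection C) {x y : V}
    (hx : x ∈ closure C.carrier) (hx0 : x ≠ 0) (hy : y ∈ C.carrier) :
    D.functional x ≤ Real.exp (C.funk x y) * D.functional y := by
  have h := (C.funk_le_iff hx hx0 hy).mp le_rfl
  rcases eq_or_ne (Real.exp (C.funk x y) • y - x) 0 with h0 | h0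
  · rw [sub_eq_zero] at h0
    nth_rewrite 1 [← h0]
    rw [map_smul, smul_eq_mul]
  · have h1 := D.pos _ h h0
    rw [map_sub, map_smul, smul_eq_mul] at h1
    linarith

theorem CrossSection.funk_nonneg (D : CrossSection C) {x y : V} (hx : x ∈ closure C.carrier)
    (hx1 : D.functional x = 1) (hy : y ∈ D.carrier) : 0 ≤ C.funk x y := by
  have hx0 : x ≠ 0 := by
    rintro rfl
    simp at hx1
  have h := D.functional_le_gauge hx hx0 hy.1
  rw [hx1, hy.2, mul_one] at h
  exact Real.one_le_exp_iff.mp h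

section Nontrivial

variable [Nontrivial V]

theorem ProperOpenCone.exists_finset_cover {Q : Set V} (hQ : IsCompact Q) (hQC : Q ⊆ C.carrier)
    {ε : ℝ} (hε : 0 < ε) :
    ∃ S : Finset Q, ∀ x ∈ Q, ∃ y ∈ S, C.funk x y < ε ∧ C.funk y x < ε := by
  classical
  obtain ⟨t, htQ, ht⟩ := hQ.elim_nhds_subcover
    (fun y => {z | z ∈ C.carrier ∧ C.funk y z < ε ∧ C.funk z y < ε})
    (fun y hy => C.eventually_funk_lt (hQC hy) hε)
  refine ⟨t.subtype (· ∈ Q), fun x hx => ?_⟩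
  obtain ⟨y, hy, hxy⟩ := mem_iUnion₂.mp (ht hx)
  exact ⟨⟨y, htQ y hy⟩, Finset.mem_subtype.mpr hy, hxy.2.2, hxy.2.1⟩

theorem ProperOpenCone.thompson_eq (x y : C.carrier) :
    C.thompson x y = max (C.funk x y) (C.funk y x) := by
  have h1 := C.gauge_pos (subset_closure x.2) (C.ne_zero_of_mem x.2) y.2
  have h2 := C.gauge_pos (subset_closure y.2) (C.ne_zero_of_mem y.2) x.2
  unfold ProperOpenCone.thompson ProperOpenCone.funk
  rcases le_total (C.gauge x y) (C.gauge y x) with h | h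
  · rw [max_eq_right h, max_eq_right (Real.log_le_log h1 h)]
  · rw [max_eq_left h, max_eq_left (Real.log_le_log h2 h)]

/-- A Funk bound is an order bound that keeps `x` away from the boundary of the cone; with a bound
on the functional it confines `x` to a compact subset of the open cone. -/
theorem ProperOpenCone.sub_smul_mem {b x : V} {R : ℝ} (hb : b ∈ C.carrier) (hx : x ∈ C.carrier)
    (h : C.funk b x ≤ R) : x - Real.exp (-R) • b ∈ closure C.carrier := by
  have h1 := (C.funk_le_iff (subset_closure hb) (C.ne_zero_of_mem hb) hx).mp h
  convert C.smul_mem_closure (Real.exp_pos (-R)).le h1 using 1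
  rw [smul_sub, smul_smul, ← Real.exp_add, neg_add_cancel, Real.exp_zero, one_smul]

theorem ProperOpenCone.thompson_nonneg (x y : C.carrier) : 0 ≤ C.thompson x y := by
  have h1 := C.funk_triangle (subset_closure x.2) (C.ne_zero_of_mem x.2) y.2 x.2
  rw [C.funk_self x.2] at h1
  rw [C.thompson_eq]
  by_contra! h
  linarith [(max_lt_iff.mp h).1, (max_lt_iff.mp h).2]

variable [FiniteDimensional ℝ V]

/-- The one-sided bound `F(b, z) ≤ R` already suffices: on `D` the functional is fixed, so a lower
order bound gives compactness. -/
theorem CrossSection.isProperDist (D : CrossSection C) : IsProperDist D.funk where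
  nonneg x y := D.funk_nonneg (subset_closure x.2.1) x.2.2 y.2
  self x := C.funk_self x.2.1
  triangle x y z := C.funk_triangle (subset_closure x.2.1) (C.ne_zero_of_mem x.2.1) y.2.1 z.2.1
  totallyBounded b R ε hε := by
    classical
    have hQ := D.isCompact_slab_above b.2.1 (Real.exp_pos (-R)) 1
    have hQC : {x : V | x - Real.exp (-R) • (b : V) ∈ closure C.carrier ∧ D.functional x ≤ 1} ∩
        {x | D.functional x = 1} ⊆ D.carrier := fun x hx =>
      ⟨C.mem_of_sub_smul_mem_closure (Real.exp_pos _) b.2.1 hx.1.1, hx.2⟩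
    obtain ⟨S, hS⟩ := C.exists_finset_cover
      (hQ.inter_right (isClosed_eq D.continuous_functional continuous_const))
      (hQC.trans fun _ h => h.1) (half_pos hε)
    refine ⟨S.image (inclusion hQC), fun x hx => ?_⟩
    have h1 : C.funk b x ≤ R := by
      have := D.funk_nonneg (subset_closure x.2.1) x.2.2 b.2
      unfold CrossSection.funk at hx
      linarith
    obtain ⟨y, hy, hxy⟩ := hS x ⟨⟨ProperOpenCone.sub_smul_mem b.2.1 x.2.1 h1, x.2.2.le⟩, x.2.2⟩
    exact ⟨_, Finset.mem_image_of_mem _ hy, (add_lt_add hxy.1 hxy.2).trans_eq (add_halves ε)⟩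
  proper b R u hu := by
    obtain ⟨z₀, hz₀, hlim⟩ := exists_tendsto_of_isCompact (u := u)
      (p := fun z : D.carrier => (z : V))
      ((D.isCompact_slab_above b.2.1 (Real.exp_pos (-R)) 1).inter_right
        (isClosed_eq D.continuous_functional continuous_const)) (by
        filter_upwards [hu] with z hz
        exact ⟨⟨ProperOpenCone.sub_smul_mem b.2.1 z.2.1 hz, z.2.2.le⟩, z.2.2⟩)
    have hzC := C.mem_of_sub_smul_mem_closure (Real.exp_pos _) b.2.1 hz₀.1.1
    refine ⟨⟨z₀, hzC, hz₀.2⟩, fun y => ?_⟩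
    have key : ∀ y : D.carrier, Tendsto (fun z => D.funk y z) u (𝓝 (C.funk y z₀)) := fun y =>
      C.tendsto_funk_right (subset_closure y.2.1) (C.ne_zero_of_mem y.2.1) hzC hlim
    exact (key y).sub (key b)

/-- Here the second half of the maximum, `F(z, b) ≤ R`, supplies the bound on the functional that
`D` had for free. -/
theorem ProperOpenCone.thompson_isProperDist (D : CrossSection C) : IsProperDist C.thompson where
  nonneg := C.thompson_nonneg
  self x := by
    rw [C.thompson_eq, C.funk_self x.2, max_self]
  triangle x y z := by
    have h1 := C.funk_triangle (subset_closure x.2) (C.ne_zero_of_mem x.2) y.2 z.2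
    have h2 := C.funk_triangle (subset_closure z.2) (C.ne_zero_of_mem z.2) y.2 x.2
    rw [C.thompson_eq, C.thompson_eq, C.thompson_eq]
    refine max_le ?_ ?_
    · exact h1.trans (add_le_add (le_max_left _ _) (le_max_left _ _))
    · rw [add_comm] at h2
      exact h2.trans (add_le_add (le_max_right _ _) (le_max_right _ _))
  totallyBounded b R ε hε := by
    classical
    have hQC : {x : V | x - Real.exp (-R) • (b : V) ∈ closure C.carrier ∧
        D.functional x ≤ Real.exp R * D.functional b} ⊆ C.carrier := fun x hx =>
      C.mem_of_sub_smul_mem_closure (Real.exp_pos _) b.2 hx.1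
    obtain ⟨S, hS⟩ := C.exists_finset_cover
      (D.isCompact_slab_above b.2 (Real.exp_pos (-R)) (Real.exp R * D.functional b)) hQC
      (half_pos hε)
    refine ⟨S.image (inclusion hQC), fun x hx => ?_⟩
    have h0 := C.thompson_nonneg x b
    have h1 := C.thompson_nonneg b x
    have h2 : max (C.funk b x) (C.funk x b) ≤ R := by
      rw [← C.thompson_eq]
      linarith
    rw [max_le_iff] at h2
    obtain ⟨y, hy, hxy⟩ := hS x ⟨ProperOpenCone.sub_smul_mem b.2 x.2 h2.1, by
      refine (D.functional_le_gauge (subset_closure x.2) (C.ne_zero_of_mem x.2) b.2).trans ?_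
      exact mul_le_mul_of_nonneg_right (Real.exp_le_exp.mpr h2.2) (D.functional_pos b).le⟩
    refine ⟨_, Finset.mem_image_of_mem _ hy, ?_⟩
    rw [C.thompson_eq, C.thompson_eq]
    exact (add_lt_add (max_lt hxy.1 hxy.2) (max_lt hxy.2 hxy.1)).trans_eq (add_halves ε)
  proper b R u hu := by
    obtain ⟨z₀, hz₀, hlim⟩ := exists_tendsto_of_isCompact (u := u)
      (p := fun z : C.carrier => (z : V))
      (D.isCompact_slab_above b.2 (Real.exp_pos (-R)) (Real.exp R * D.functional b)) (by
        filter_upwards [hu] with z hz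
        rw [C.thompson_eq, max_le_iff] at hz
        refine ⟨ProperOpenCone.sub_smul_mem b.2 z.2 hz.1, ?_⟩
        refine (D.functional_le_gauge (subset_closure z.2) (C.ne_zero_of_mem z.2) b.2).trans ?_
        exact mul_le_mul_of_nonneg_right (Real.exp_le_exp.mpr hz.2) (D.functional_pos b).le)
    have hzC := C.mem_of_sub_smul_mem_closure (Real.exp_pos _) b.2 hz₀.1
    refine ⟨⟨z₀, hzC⟩, fun y => ?_⟩
    have key : ∀ y : C.carrier, Tendsto (fun z => C.thompson y z) u
        (𝓝 (C.thompson y ⟨z₀, hzC⟩)) := fun y => by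
      simp only [C.thompson_eq]
      exact (C.tendsto_funk_right (subset_closure y.2) (C.ne_zero_of_mem y.2) hzC hlim).max
        (C.tendsto_funk_left (subset_closure hzC) (C.ne_zero_of_mem hzC) y.2
          (fun z => subset_closure z.2) (fun z => C.ne_zero_of_mem z.2) hlim)
    exact (key y).sub (key b)

end Nontrivial

end ThompsonHoro

/-! ### Limits of brackets. -/

namespace ThompsonHoro

section Bracket

variable {X ι : Type*} {l : Filter ι} {f₁ f₂ : X → ℝ} {y : X}

/-- At an infinite `γ`, one of the two terms eventually drops below the other and disappears from
the maximum. -/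
theorem tendsto_bracket {R G c : ι → ℝ} {γ : EReal} (hR : Tendsto R l (𝓝 (f₁ y)))
    (hG : Tendsto G l (𝓝 (f₂ y))) (hc : Tendsto (fun i => (c i : EReal)) l (𝓝 γ)) :
    Tendsto (fun i => max (R i + min (c i) 0) (G i - max (c i) 0)) l
      (𝓝 (bracket f₁ f₂ γ y)) := by
  induction γ with
  | coe γ =>
    rw [EReal.tendsto_coe] at hc
    rw [bracket_coe]
    exact (hR.add (hc.min tendsto_const_nhds)).max (hG.sub (hc.max tendsto_const_nhds))
  | top =>
    rw [EReal.tendsto_coe_nhds_top_iff] at hc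
    rw [bracket_top]
    refine hR.congr' ?_
    filter_upwards [hc.eventually_ge_atTop 0, hc.eventually_ge_atTop (f₂ y + 1 - (f₁ y - 1)),
      hR.eventually_const_lt (sub_one_lt _), hG.eventually_lt_const (lt_add_one _)]
      with i h1 h2 h3 h4
    rw [min_eq_right h1, max_eq_left h1, add_zero, max_eq_left]
    linarith
  | bot =>
    rw [EReal.tendsto_coe_nhds_bot_iff] at hc
    rw [bracket_bot]
    refine hG.congr' ?_
    filter_upwards [hc.eventually_le_atBot 0, hc.eventually_le_atBot (f₂ y - 1 - (f₁ y + 1)),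
      hG.eventually_const_lt (sub_one_lt _), hR.eventually_lt_const (lt_add_one _)]
      with i h1 h2 h3 h4
    rw [min_eq_left h1, max_eq_right h1, sub_zero, max_eq_right]
    linarith

/-- Every extended real number is the limit of real numbers `c n` with which the value of a
bracket compensates a maximum of two numbers that differ by `c n`. -/
theorem exists_seq_bracket_add (γ : EReal) :
    ∃ c : ℕ → ℝ, Tendsto (fun n => (c n : EReal)) atTop (𝓝 γ) ∧
      ∀ {X : Type*} (f₁ f₂ : X → ℝ) (y : X) (n : ℕ) (a e : ℝ), e - a = c n →
        max a e + bracket f₁ f₂ γ y ≤ max (f₁ y + e) (f₂ y + a) := by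
  induction γ with
  | coe γ =>
    refine ⟨fun _ => γ, tendsto_const_nhds, fun f₁ f₂ y n a e h => ?_⟩
    rw [bracket_coe]
    subst h
    rcases le_total a e with h | h
    · rw [max_eq_right h, min_eq_right (sub_nonneg.mpr h), max_eq_left (b := (0 : ℝ))
        (sub_nonneg.mpr h), ← max_add_add_left]
      exact max_le_max (by linarith) (by linarith)
    · rw [max_eq_left h, min_eq_left (sub_nonpos.mpr h), max_eq_right (b := (0 : ℝ))
        (sub_nonpos.mpr h), ← max_add_add_left]
      exact max_le_max (by linarith) (by linarith)
  | top =>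
    refine ⟨fun n => n, EReal.tendsto_coe_nhds_top_iff.mpr tendsto_natCast_atTop_atTop,
      fun f₁ f₂ y n a e h => ?_⟩
    have hn : (0 : ℝ) ≤ n := n.cast_nonneg
    rw [bracket_top, max_eq_right (by linarith), add_comm]
    exact le_max_left _ _
  | bot =>
    refine ⟨fun n => -n, EReal.tendsto_coe_nhds_bot_iff.mpr
      (tendsto_neg_atTop_atBot.comp tendsto_natCast_atTop_atTop), fun f₁ f₂ y n a e h => ?_⟩
    have hn : (0 : ℝ) ≤ n := n.cast_nonneg
    rw [bracket_bot, max_eq_left (by linarith), add_comm]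
    exact le_max_right _ _

theorem le_bracket {γ : EReal} (hγ : γ ≠ ⊤) : f₂ y - (max γ 0).toReal ≤ bracket f₁ f₂ γ y := by
  induction γ with
  | coe γ =>
    rw [bracket_coe, ← EReal.coe_zero, ← EReal.coe_strictMono.monotone.map_max,
      EReal.toReal_coe]
    exact le_max_right _ _
  | top => exact absurd rfl hγ
  | bot => simp [bracket_bot]

/-- With `p n` the multiple of `y` by `e^n`, this reads `f₂`, up to the constant `γ⁺`, off the
bracket alone. `tendsto_bracket_top_sub` shows that the value `⊤` is detected in the same way. -/
theorem tendsto_bracket_sub {γ : EReal} (hγ : γ ≠ ⊤) {p : ℕ → X}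
    (h₁ : ∀ n, f₁ (p n) = f₁ y - n) (h₂ : ∀ n, f₂ (p n) = f₂ y + n) :
    Tendsto (fun n => bracket f₁ f₂ γ (p n) - n) atTop (𝓝 (f₂ y - (max γ 0).toReal)) := by
  induction γ with
  | coe γ =>
    refine tendsto_const_nhds.congr' ?_
    filter_upwards [tendsto_natCast_atTop_atTop.eventually_ge_atTop
      (|f₁ y + min γ 0 - (f₂ y - max γ 0)|)] with n hn
    have h := le_abs_self (f₁ y + min γ 0 - (f₂ y - max γ 0))
    have hn0 : (0 : ℝ) ≤ n := n.cast_nonneg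
    have hle : f₁ y - n + min γ 0 ≤ f₂ y + n - max γ 0 := by linarith
    rw [bracket_coe, ← EReal.coe_zero, ← EReal.coe_strictMono.monotone.map_max,
      EReal.toReal_coe, h₁, h₂, max_eq_right hle]
    ring
  | top => exact absurd rfl hγ
  | bot => simp [bracket_bot, h₂]

theorem tendsto_bracket_top_sub {p : ℕ → X} (h₁ : ∀ n, f₁ (p n) = f₁ y - n) :
    Tendsto (fun n => bracket f₁ f₂ ⊤ (p n) - n) atTop atBot := by
  simp only [bracket_top, h₁]
  refine tendsto_atBot_mono (fun n => (?_ : f₁ y - (n : ℝ) - n ≤ f₁ y - n)) ?_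
  · have hn0 : (0 : ℝ) ≤ n := n.cast_nonneg
    linarith
  · simp only [sub_eq_add_neg]
    exact tendsto_atBot_add_const_left _ _
      (tendsto_neg_atTop_atBot.comp tendsto_natCast_atTop_atTop)

end Bracket

/-! ### Homogeneity of the functions on the cone, and translation by a boundary point. -/

variable {V : Type*} [NormedAddCommGroup V] [NormedSpace ℝ V] {C : ProperOpenCone V}

/-- The positive multiple `t • y` of a point of the cone. -/
def ProperOpenCone.scale (y : C.carrier) (t : ℝ) (ht : 0 < t) : C.carrier :=
  ⟨t • (y : V), C.smul_mem ht y.2⟩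

/-- The translate of a point of the cone by a non-negative multiple of a point of its closure. -/
def ProperOpenCone.translate (y : C.carrier) {x : V} (hx : x ∈ closure C.carrier) (t : ℝ)
    (ht : 0 ≤ t) : C.carrier :=
  ⟨t • x + (y : V), C.closure_add_mem (C.smul_mem_closure ht hx) y.2⟩

/-- The inclusion of a cross section in the cone. -/
def CrossSection.toCone (D : CrossSection C) (y : D.carrier) : C.carrier := ⟨y, y.2.1⟩

namespace ProperOpenCone

variable [Nontrivial V] (C) (b : C.carrier)

theorem fC_eq {w : V} (hw : w ∈ C.carrier) (y : C.carrier) :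
    C.fC b w y = C.funk y w - C.funk b w :=
  Real.log_div (C.gauge_pos (subset_closure y.2) (C.ne_zero_of_mem y.2) hw).ne'
    (C.gauge_pos (subset_closure b.2) (C.ne_zero_of_mem b.2) hw).ne'

theorem fC_smul {w : V} (hw : w ∈ C.carrier) {s : ℝ} (hs : 0 < s) (y : C.carrier) :
    C.fC b (s • w) y = C.fC b w y := by
  rw [C.fC_eq b hw, C.fC_eq b (C.smul_mem hs hw),
    C.funk_smul_right hs (subset_closure y.2) (C.ne_zero_of_mem y.2) hw,
    C.funk_smul_right hs (subset_closure b.2) (C.ne_zero_of_mem b.2) hw]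
  ring

omit [Nontrivial V] in
theorem r_eq (x : V) (y : C.carrier) : C.r b x y = C.funk x y - C.funk x b := rfl

theorem r_smul {w : V} (hw : w ∈ C.carrier) {s : ℝ} (hs : 0 < s) (y : C.carrier) :
    C.r b (s • w) y = C.r b w y := by
  rw [r_eq, r_eq, C.funk_smul_left hs (subset_closure hw) (C.ne_zero_of_mem hw) y.2,
    C.funk_smul_left hs (subset_closure hw) (C.ne_zero_of_mem hw) b.2]
  ring

omit [Nontrivial V] in
theorem r_scale {x : V} (hx : x ∈ closure C.carrier) (hx0 : x ≠ 0) (y : C.carrier) {t : ℝ}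
    (ht : 0 < t) : C.r b x (scale y t ht) = C.r b x y - Real.log t := by
  have h : C.funk x (scale y t ht) = C.funk x y - Real.log t :=
    C.funk_smul_right ht hx hx0 y.2
  rw [r_eq, r_eq, h]
  ring

/-- Subtracting `d_T(b, z) = max(F(z, b), F(b, z))` inside the maximum leaves each term its own
normalisation, minus what the larger base distance exceeds it by. -/
theorem thompson_sub (y z : C.carrier) :
    C.thompson y z - C.thompson b z =
      max (C.r b z y + min (C.funk z b - C.funk b z) 0)
        (C.fC b z y - max (C.funk z b - C.funk b z) 0) := by
  rw [C.fC_eq b z.2, r_eq, C.thompson_eq, C.thompson_eq, max_comm]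
  rcases le_total (C.funk b z) (C.funk z b) with h | h
  · rw [max_eq_right h, min_eq_right (sub_nonneg.mpr h), max_eq_left (b := (0 : ℝ))
      (sub_nonneg.mpr h), ← max_sub_sub_right]
    congr 1 <;> ring
  · rw [max_eq_left h, min_eq_left (sub_nonpos.mpr h), max_eq_right (b := (0 : ℝ))
      (sub_nonpos.mpr h), ← max_sub_sub_right]
    congr 1 <;> ring

end ProperOpenCone

namespace CrossSection

variable [Nontrivial V] (D : CrossSection C) (b : C.carrier)

theorem coe_proj (y : C.carrier) : (D.proj y : V) = (D.functional y)⁻¹ • (y : V) := rfl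

theorem proj_toCone (y : D.carrier) : D.proj (D.toCone y) = y := by
  apply Subtype.ext
  rw [coe_proj]
  have : D.functional (D.toCone y) = 1 := y.2.2
  rw [this, inv_one, one_smul]
  rfl

theorem funk_proj (y z : C.carrier) :
    D.funk (D.proj y) (D.proj z) =
      C.funk y z - Real.log (D.functional y) + Real.log (D.functional z) := by
  have hy := inv_pos.mpr (D.functional_pos y)
  have hz := inv_pos.mpr (D.functional_pos z)
  unfold CrossSection.funk
  rw [coe_proj, coe_proj, C.funk_smul_left hy (subset_closure y.2) (C.ne_zero_of_mem y.2)
      (C.smul_mem hz z.2), C.funk_smul_right hz (subset_closure y.2) (C.ne_zero_of_mem y.2) z.2,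
    Real.log_inv, Real.log_inv]
  ring

theorem extend_eq (f : D.carrier → ℝ) (y : C.carrier) :
    D.extend b f y =
      f (D.proj y) + (Real.log (D.functional y) - Real.log (D.functional b)) := by
  rw [← Real.log_div (D.functional_pos y).ne' (D.functional_pos b).ne']
  rfl

theorem fC_eq_funk_proj (w : D.carrier) (y : C.carrier) :
    C.fC b w y = D.funk (D.proj y) w - D.funk (D.proj b) w +
      (Real.log (D.functional y) - Real.log (D.functional b)) := by
  have h1 := D.funk_proj y (D.toCone w)
  have h2 := D.funk_proj b (D.toCone w)
  rw [proj_toCone] at h1 h2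
  rw [h1, h2, C.fC_eq b w.2.1]
  change C.funk y w - C.funk b w = C.funk y w - _ + _ - (C.funk b w - _ + _) + _
  ring

theorem extend_injective : Function.Injective (D.extend b) := by
  intro f f' h
  funext y
  have h1 := congrFun h (D.toCone y)
  rw [extend_eq, extend_eq, proj_toCone] at h1
  linarith

theorem extend_scale (f : D.carrier → ℝ) (y : C.carrier) {t : ℝ} (ht : 0 < t) :
    D.extend b f (ProperOpenCone.scale y t ht) = D.extend b f y + Real.log t := by
  have h1 : D.functional (ProperOpenCone.scale y t ht) = t * D.functional y :=
    map_smul _ _ _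
  have h2 : D.proj (ProperOpenCone.scale y t ht) = D.proj y := by
    apply Subtype.ext
    rw [coe_proj, coe_proj, h1]
    change _ • (t • (y : V)) = _
    rw [smul_smul, mul_inv, mul_right_comm, inv_mul_cancel₀ ht.ne', one_mul]
  rw [extend_eq, extend_eq, h1, h2, Real.log_mul ht.ne' (D.functional_pos y).ne']
  ring

theorem extend_eq_fC {f : D.carrier → ℝ} {w : D.carrier}
    (h : ∀ y, f y = D.funk y w - D.funk (D.proj b) w) : D.extend b f = C.fC b w := by
  funext y
  rw [extend_eq, fC_eq_funk_proj, h]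

theorem tendsto_fC {ι : Type*} {l : Filter ι} {w : ι → D.carrier} {f : D.carrier → ℝ}
    (h : ∀ y, Tendsto (fun i => D.funk y (w i) - D.funk (D.proj b) (w i)) l (𝓝 (f y)))
    (y : C.carrier) : Tendsto (fun i => C.fC b (w i) y) l (𝓝 (D.extend b f y)) := by
  simp only [fC_eq_funk_proj]
  rw [extend_eq]
  exact (h _).add_const _

/-- The Funk defect is constant on rays: the logarithms of `F(b, ·)` and of the extension cancel. It
can thus be computed at any representative in the cone. -/
theorem funk_add_extend (f : D.carrier → ℝ) (z : C.carrier) :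
    D.funk (D.proj b) (D.proj z) + f (D.proj z) = C.funk b z + D.extend b f z := by
  rw [funk_proj, extend_eq]
  ring

end CrossSection

section Translation

variable [Nontrivial V] {b : C.carrier} {ι : Type*} {l : Filter ι} [l.NeBot] {g : C.carrier → ℝ}

theorem ProperOpenCone.sub_le_funk {w : ι → V} (hw : ∀ i, w i ∈ C.carrier)
    (hg : ∀ y, Tendsto (fun i => C.fC b (w i) y) l (𝓝 (g y))) (y y' : C.carrier) :
    g y - g y' ≤ C.funk y y' := by
  refine le_of_tendsto ((hg y).sub (hg y')) (Eventually.of_forall fun i => ?_)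
  have h := C.funk_triangle (subset_closure y.2) (C.ne_zero_of_mem y.2) y'.2 (hw i)
  rw [C.fC_eq b (hw i), C.fC_eq b (hw i)]
  linarith

/-- A limit of the functions `fC b (w i)`, for points `w i` of the cone that tend to a point `x` of
its boundary, is invariant under translations by `x`. -/
theorem ProperOpenCone.limit_translate {w : ι → V} {x : V} (hw : ∀ i, w i ∈ C.carrier)
    (hx : x ∈ closure C.carrier) (hxC : x ∉ C.carrier) (hlim : Tendsto w l (𝓝 x))
    (hg : ∀ y, Tendsto (fun i => C.fC b (w i) y) l (𝓝 (g y))) (y : C.carrier) {τ : ℝ}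
    (hτ : 0 ≤ τ) : g (translate y hx τ hτ) = g y := by
  have hb0 := C.ne_zero_of_mem b.2
  have hy0 := C.ne_zero_of_mem y.2
  have hbpos := fun i => C.gauge_pos (subset_closure b.2) hb0 (hw i)
  have hypos := fun i => C.gauge_pos (subset_closure y.2) hy0 (hw i)
  set p := translate y hx τ hτ with hp
  -- Translating by `w i` instead of `x` makes the gauge exactly additive, `M(y + τ w, w) = M(y, w)
  -- + τ`. The extra `τ` is negligible because `M(b, w i)` tends to infinity, and `q i` tends to
  -- `p`.
  let q : ι → C.carrier := fun i => translate y (subset_closure (hw i)) τ hτ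
  have hq : Tendsto (fun i => (q i : V)) l (𝓝 p) := (hlim.const_smul τ).add_const _
  have hlimq : Tendsto (fun i => C.fC b (w i) (q i)) l (𝓝 (g y)) := by
    have h1 : ∀ i, C.fC b (w i) (q i) =
        Real.log (Real.exp (C.fC b (w i) y) + τ / C.gauge b (w i)) := by
      intro i
      have h2 : C.gauge (q i) (w i) = C.gauge y (w i) + τ := by
        rw [← C.gauge_add_smul hτ (subset_closure y.2) hy0 (hw i), add_comm]
        rfl
      unfold fC
      rw [Real.exp_log (div_pos (hypos i) (hbpos i)), h2, add_div]
    simp only [h1]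
    have h3 : Tendsto (fun i => τ / C.gauge b (w i)) l (𝓝 0) :=
      (C.tendsto_gauge_atTop b.2 hb0 hxC hw hlim).const_div_atTop τ
    have h4 := ((Real.continuous_exp.tendsto _).comp (hg y)).add h3
    rw [add_zero] at h4
    have h5 := h4.log (Real.exp_pos _).ne'
    rwa [Real.log_exp] at h5
  have hp0 := C.ne_zero_of_mem p.2
  refine le_antisymm ?_ ?_
  · have h1 := C.tendsto_funk_right (subset_closure p.2) hp0 p.2 hq
    rw [C.funk_self p.2] at h1
    refine le_of_sub_nonpos (le_of_tendsto_of_tendsto' ((hg p).sub hlimq) h1 fun i => ?_)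
    have h2 := C.funk_triangle (subset_closure p.2) hp0 (q i).2 (hw i)
    rw [C.fC_eq b (hw i), C.fC_eq b (hw i)]
    linarith
  · have h1 := C.tendsto_funk_left (subset_closure p.2) hp0 p.2
      (fun i => subset_closure (q i).2) (fun i => C.ne_zero_of_mem (q i).2) hq
    rw [C.funk_self p.2] at h1
    refine le_of_sub_nonpos (le_of_tendsto_of_tendsto' (hlimq.sub (hg p)) h1 fun i => ?_)
    have h2 := C.funk_triangle (subset_closure (q i).2) (C.ne_zero_of_mem (q i).2) p.2 (hw i)
    rw [C.fC_eq b (hw i), C.fC_eq b (hw i)]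
    linarith

variable [FiniteDimensional ℝ V]

/-- A limit of points of the Funk geometry that tend to a boundary point is not a point. -/
theorem CrossSection.not_exists_funk (D : CrossSection C) {w : ι → D.carrier} {x : V}
    (hx : x ∈ D.boundary) (hlim : Tendsto (fun i => (w i : V)) l (𝓝 x)) {f : D.carrier → ℝ}
    (hf : ∀ y, Tendsto (fun i => D.funk y (w i) - D.funk (D.proj b) (w i)) l (𝓝 (f y))) :
    ¬ ∃ z, ∀ y, f y = D.funk y z - D.funk (D.proj b) z := by
  rintro ⟨z, hz⟩
  have hx1 := D.functional_eq_one_of_mem_closure hx.1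
  have hxC : x ∉ C.carrier := fun h => hx.2 ⟨h, hx1⟩
  have hxK := D.mem_closure_cone hx.1
  -- Translation invariance at `z` would give `F(z + x, z) = F(z, z) = 0`, hence `φ(z + x) ≤ φ(z)`,
  -- whereas these values are `2` and `1`.
  have h1 := C.limit_translate (fun i => (w i).2.1) hxK hxC hlim (D.tendsto_fC b hf)
    (D.toCone z) zero_le_one
  rw [D.extend_eq_fC b hz, C.fC_eq b z.2.1, C.fC_eq b z.2.1] at h1
  have h2 : C.funk (D.toCone z) z = 0 := C.funk_self z.2.1
  set p := ProperOpenCone.translate (D.toCone z) hxK 1 zero_le_one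
  have h3 := D.functional_le_gauge (subset_closure p.2) (C.ne_zero_of_mem p.2) z.2.1
  have h4 : D.functional p = 2 := by
    change D.functional ((1 : ℝ) • x + (z : V)) = 2
    rw [one_smul, map_add, hx1, z.2.2]
    norm_num
  rw [h4, z.2.2, show C.funk p z = 0 by linarith, Real.exp_zero] at h3
  norm_num at h3

end Translation

end ThompsonHoro

/-! ### Horofunctions and Busemann points of the Thompson metric. -/

namespace ThompsonHoro

variable {V : Type*} [NormedAddCommGroup V] [NormedSpace ℝ V] {C : ProperOpenCone V}
  [Nontrivial V] {b : C.carrier} {g : C.carrier → ℝ}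

/-- A bracket is unbounded below, whereas the functions `d · z - d b z` are not. -/
theorem ProperOpenCone.not_exists_thompson {x : V} (hx : x ∈ closure C.carrier) (hx0 : x ≠ 0)
    (hg : ∀ y t (ht : 0 < t), g (scale y t ht) = g y + Real.log t) {c : EReal}
    (hc : c = ⊤ ∨ c = ⊥ ∨ ∀ y τ (hτ : 0 ≤ τ), g (translate y hx τ hτ) = g y) :
    ¬ ∃ z, ∀ y, bracket (C.r b x) g c y = C.thompson y z - C.thompson b z := by
  rintro ⟨z, hz⟩
  suffices h : ∃ y, bracket (C.r b x) g c y < -C.thompson b z by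
    obtain ⟨y, hy⟩ := h
    have h1 := C.thompson_nonneg y z
    linarith [hz y]
  set B := C.thompson b z
  induction c with
  | top =>
    refine ⟨scale b (Real.exp (B + 1)) (Real.exp_pos _), ?_⟩
    rw [bracket_top, C.r_scale b hx hx0, Real.log_exp, r_eq]
    linarith
  | bot =>
    refine ⟨scale b (Real.exp (-(B + 1) - g b)) (Real.exp_pos _), ?_⟩
    rw [bracket_bot, hg, Real.log_exp]
    linarith
  | coe c =>
    have hc' := (hc.resolve_left (EReal.coe_ne_top c)).resolve_left (EReal.coe_ne_bot c)
    -- The scale makes `g y - max c 0 = -(B + 1)`. Translating by `τ • x` preserves this, and as the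
    -- translate dominates `τ • x`, the chosen `τ` brings the other term to at most `-(B + 1)`.
    set y := scale b (Real.exp (-(B + 1) - g b + max c 0)) (Real.exp_pos _) with hy
    set τ := Real.exp (B + 1 - C.funk x b + min c 0) with hτ
    have hτ0 : 0 < τ := Real.exp_pos _
    refine ⟨translate y hx τ hτ0.le, ?_⟩
    rw [bracket_coe, hc', hg, Real.log_exp]
    refine max_lt ?_ (by linarith)
    have h1 : C.funk x (translate y hx τ hτ0.le) ≤ -(B + 1 - C.funk x b + min c 0) := by
      rw [C.funk_le_iff hx hx0 (translate y hx τ hτ0.le).2, Real.exp_neg, ← hτ]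
      have h2 := C.smul_mem_closure (inv_pos.mpr hτ0).le (subset_closure y.2)
      convert h2 using 1
      change τ⁻¹ • (τ • x + (y : V)) - x = _
      rw [smul_add, inv_smul_smul₀ hτ0.ne']
      abel
    rw [r_eq]
    linarith

/-- Rescaling `w n` changes neither of the two functions in the bracket, so `F(z, b) - F(b, z)` can
be prescribed to tend to `c`. The second conclusion bounds the Thompson defect by quantities
depending on `w n` only. -/
theorem CrossSection.exists_seq_tendsto_bracket (D : CrossSection C) {x : V}
    (hx : x ∈ closure C.carrier) (hx0 : x ≠ 0)
    (hg : ∀ y t (ht : 0 < t), g (ProperOpenCone.scale y t ht) = g y + Real.log t)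
    {w : ℕ → D.carrier} (hlim : Tendsto (fun n => (w n : V)) atTop (𝓝 x))
    (hw : ∀ y, Tendsto (fun n => C.fC b (w n) y) atTop (𝓝 (g y))) (c : EReal) :
    ∃ z : ℕ → C.carrier,
      (∀ y, Tendsto (fun n => C.thompson y (z n) - C.thompson b (z n)) atTop
        (𝓝 (bracket (C.r b x) g c y))) ∧
      ∀ n, C.thompson b (z n) + bracket (C.r b x) g c (z n) ≤
        max (C.funk x (w n) - C.funk x b + C.funk (w n) b)
          (g (D.toCone (w n)) + C.funk b (w n)) := by
  have hw0 : ∀ n, (w n : V) ≠ 0 := fun n => C.ne_zero_of_mem (w n).2.1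
  obtain ⟨γ, hγ, hbr⟩ := exists_seq_bracket_add c
  -- Scaling by `e^s` raises `F(·, b)` and lowers `F(b, ·)` by `s`, hence the half.
  let s : ℕ → ℝ := fun n => (γ n - (C.funk (w n) b - C.funk b (w n))) / 2
  let z : ℕ → C.carrier := fun n =>
    ProperOpenCone.scale (D.toCone (w n)) (Real.exp (s n)) (Real.exp_pos _)
  have hz1 : ∀ n, C.funk (z n) b = C.funk (w n) b + s n := by
    intro n
    have h := C.funk_smul_left (Real.exp_pos (s n)) (subset_closure (w n).2.1) (hw0 n) b.2
    rwa [Real.log_exp] at h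
  have hz2 : ∀ {y : V}, y ∈ closure C.carrier → y ≠ 0 → ∀ n,
      C.funk y (z n) = C.funk y (w n) - s n := by
    intro y hy hy0 n
    have h := C.funk_smul_right (Real.exp_pos (s n)) hy hy0 (w n).2.1
    rwa [Real.log_exp] at h
  have hb0 := C.ne_zero_of_mem b.2
  have hc : ∀ n, C.funk (z n) b - C.funk b (z n) = γ n := by
    intro n
    rw [hz1, hz2 (subset_closure b.2) hb0]
    simp only [s]
    ring
  refine ⟨z, fun y => ?_, fun n => ?_⟩
  · simp only [C.thompson_sub, hc]
    refine tendsto_bracket ?_ ?_ hγ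
    · refine Tendsto.congr (fun n => (C.r_smul b (w n).2.1 (Real.exp_pos (s n)) y).symm) ?_
      have key : ∀ y : C.carrier, Tendsto (fun n => C.funk (w n) y) atTop (𝓝 (C.funk x y)) :=
        fun y => C.tendsto_funk_left hx hx0 y.2 (fun n => subset_closure (w n).2.1) hw0 hlim
      exact (key y).sub (key b)
    · exact Tendsto.congr (fun n => (C.fC_smul b (w n).2.1 (Real.exp_pos (s n)) y).symm) (hw y)
  · have h := hbr (C.r b x) g (z n) n (C.funk b (z n)) (C.funk (z n) b) (hc n)
    rw [C.thompson_eq]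
    refine h.trans (max_le_max (le_of_eq ?_) (le_of_eq ?_))
    · rw [C.r_eq, hz1, hz2 hx hx0]
      ring
    · rw [hg, Real.log_exp, hz2 (subset_closure b.2) hb0]
      ring

variable [FiniteDimensional ℝ V]

/-- Along an ultrafilter on the cone, the functions of the Thompson geometry tend to a bracket. -/
theorem CrossSection.exists_bracket_of_ultrafilter (D : CrossSection C) {ξ : C.carrier → ℝ}
    {u : Ultrafilter C.carrier}
    (hu : ∀ y, Tendsto (fun z => C.thompson y z - C.thompson b z) u (𝓝 (ξ y))) :
    ∃ x ∈ closure D.carrier, ∃ (f : D.carrier → ℝ) (c : EReal),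
      Tendsto (fun z => (D.proj z : V)) u (𝓝 x) ∧
      (∀ y, Tendsto (fun z => D.funk y (D.proj z) - D.funk (D.proj b) (D.proj z)) u (𝓝 (f y))) ∧
      Tendsto (fun z : C.carrier => ((C.funk z b - C.funk b z : ℝ) : EReal)) u (𝓝 c) ∧
      ξ = bracket (C.r b x) (D.extend b f) c := by
  obtain ⟨x, -, hx⟩ := exists_tendsto_of_isCompact (u := u) (p := fun z => (D.proj z : V))
    (D.isCompact_slab 1)
    (Eventually.of_forall fun z => ⟨subset_closure (D.proj z).2.1, (D.proj z).2.2.le⟩)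
  have hxD : x ∈ closure D.carrier :=
    mem_closure_of_tendsto hx (Eventually.of_forall fun z => (D.proj z).2)
  obtain ⟨f, hf⟩ := D.isProperDist.exists_ultrafilter_limit (D.proj b) u D.proj
  obtain ⟨c, -, hc⟩ := exists_tendsto_of_isCompact (u := u) (isCompact_univ (X := EReal))
    (p := fun z : C.carrier => ((C.funk z b - C.funk b z : ℝ) : EReal))
    (Eventually.of_forall fun z => mem_univ _)
  refine ⟨x, hxD, f, c, hx, hf, hc, funext fun y => tendsto_nhds_unique (hu y) ?_⟩
  simp only [C.thompson_sub]
  refine tendsto_bracket ?_ ?_ hc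
  · have key : ∀ y : C.carrier, Tendsto (fun z : C.carrier => C.funk (D.proj z) y) u
        (𝓝 (C.funk x y)) := fun y =>
      C.tendsto_funk_left (D.mem_closure_cone hxD) (D.ne_zero_of_mem_closure hxD) y.2
        (fun z => subset_closure (D.proj z).2.1) (fun z => C.ne_zero_of_mem (D.proj z).2.1) hx
    exact Tendsto.congr
      (fun z => C.r_smul b z.2 (inv_pos.mpr (D.functional_pos z)) y) ((key y).sub (key b))
  · exact Tendsto.congr
      (fun z => C.fC_smul b z.2 (inv_pos.mpr (D.functional_pos z)) y) (D.tendsto_fC b hf y)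

namespace CrossSection

variable (D : CrossSection C) {x : V} {f : D.carrier → ℝ}

omit [Nontrivial V] in
theorem not_mem_cone_of_mem_boundary (hx : x ∈ D.boundary) : x ∉ C.carrier :=
  fun h => hx.2 ⟨h, D.functional_eq_one_of_mem_closure hx.1⟩

/-- The limits that occur in `A` and `B`, along a filter. -/
theorem exists_seq_of_tendsto {ι : Type*} {l : Filter ι} [l.NeBot] {w : ι → D.carrier}
    (hx : Tendsto (fun i => (w i : V)) l (𝓝 x))
    (hf : ∀ y, Tendsto (fun i => D.funk y (w i) - D.funk (D.proj b) (w i)) l (𝓝 (f y))) :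
    ∃ z : ℕ → D.carrier, Tendsto (fun n => (z n : V)) atTop (𝓝 x) ∧
      HoroConverges D.funk (D.proj b) atTop z f := by
  obtain ⟨s, hs, hs'⟩ := D.isProperDist.exists_seq hf
    (P := fun n i => dist (w i : V) x < 1 / ((n : ℝ) + 1))
    (fun n => Metric.tendsto_nhds.mp hx _ (by positivity))
  refine ⟨fun n => w (s n), ?_, D.isProperDist.horoConverges_iff.mpr hs'⟩
  rw [tendsto_iff_dist_tendsto_zero]
  exact squeeze_zero (fun n => dist_nonneg) (fun n => (hs n).le)
    tendsto_one_div_add_atTop_nhds_zero_nat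

theorem extend_translate (hx : x ∈ D.boundary) {w : ℕ → D.carrier}
    (hw : Tendsto (fun n => (w n : V)) atTop (𝓝 x))
    (hf : HoroConverges D.funk (D.proj b) atTop w f) (y : C.carrier) (τ : ℝ) (hτ : 0 ≤ τ) :
    D.extend b f (ProperOpenCone.translate y (D.mem_closure_cone hx.1) τ hτ) =
      D.extend b f y :=
  C.limit_translate (fun n => (w n).2.1) _ (D.not_mem_cone_of_mem_boundary hx) hw
    (D.tendsto_fC b (D.isProperDist.horoConverges_iff.mp hf)) y hτ

theorem bracket_mem_horofunctionBoundary (hx : x ∈ D.boundary) (hf : f ∈ D.A b x) (c : EReal) :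
    bracket (C.r b x) (D.extend b f) c ∈ horofunctionBoundary C.thompson b := by
  obtain ⟨-, w, hw, hconv⟩ := hf
  have hxK := D.mem_closure_cone hx.1
  have hx0 := D.ne_zero_of_mem_closure hx.1
  obtain ⟨z, hz, -⟩ := D.exists_seq_tendsto_bracket hxK hx0 (fun y t => D.extend_scale b f y) hw
    (D.tendsto_fC b (D.isProperDist.horoConverges_iff.mp hconv)) c
  exact (C.thompson_isProperDist D).mem_horofunctionBoundary_of_tendsto hz
    (C.not_exists_thompson hxK hx0 (fun y t => D.extend_scale b f y)
      (Or.inr (Or.inr fun y τ hτ => D.extend_translate hx hw hconv y τ hτ)))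

/-- Multiples of the single point `x`, going out to infinity or in to the apex, have defect at most
zero. -/
theorem bracket_mem_busemannPoints_of_mem (x : D.carrier) {c : EReal} (hc : c = ⊤ ∨ c = ⊥) :
    bracket (C.r b x) (C.fC b x) c ∈ busemannPoints C.thompson b := by
  have hxK := subset_closure x.2.1
  have hx0 := C.ne_zero_of_mem x.2.1
  have hg : ∀ y t (ht : 0 < t),
      C.fC b x (ProperOpenCone.scale y t ht) = C.fC b x y + Real.log t := by
    rw [← D.extend_eq_fC b (w := x) (fun y => rfl)]
    exact fun y t => D.extend_scale b _ y
  obtain ⟨z, hz, hz'⟩ := D.exists_seq_tendsto_bracket (w := fun _ => x) hxK hx0 hg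
    tendsto_const_nhds (fun y => tendsto_const_nhds) c
  refine (C.thompson_isProperDist D).mem_busemannPoints_of_seq
    (C.not_exists_thompson hxK hx0 hg (by tauto)) hz fun n => ?_
  refine (hz' n).trans_lt ?_
  have h1 : C.fC b x (D.toCone x) = C.funk x x - C.funk b x := C.fC_eq b x.2.1 _
  rw [h1, C.funk_self x.2.1, zero_sub, neg_add_cancel, zero_sub, neg_add_cancel, max_self]
  positivity

/-- The segment from the base-point to `x` is a geodesic of the Funk metric that tends to `x`. -/
theorem B_nonempty (hx : x ∈ D.boundary) : (D.B b x).Nonempty := by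
  have hxK := D.mem_closure_cone hx.1
  have hx1 := D.functional_eq_one_of_mem_closure hx.1
  have hxC := D.not_mem_cone_of_mem_boundary hx
  set p := D.proj b with hp
  have hp0 := C.ne_zero_of_mem p.2.1
  have hn : ∀ n : ℕ, (0 : ℝ) < n + 1 := fun n => by positivity
  -- These points of the segment are chosen so that `(n + 1) z n - (m + 1) z m = (n - m) x`, which
  -- lies in the closed cone for `m ≤ n`.
  have hzmem : ∀ n : ℕ, ((n : ℝ) + 1)⁻¹ • ((n : ℝ) • x + (p : V)) ∈ D.carrier := by
    intro n
    refine ⟨C.smul_mem (inv_pos.mpr (hn n)) (C.closure_add_mem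
      (C.smul_mem_closure n.cast_nonneg hxK) p.2.1), ?_⟩
    rw [map_smul, map_add, map_smul, hx1, p.2.2, smul_eq_mul, smul_eq_mul, mul_one,
      inv_mul_cancel₀ (hn n).ne']
  let z : ℕ → D.carrier := fun n => ⟨_, hzmem n⟩
  have hz : ∀ n : ℕ, ((n : ℝ) + 1) • (z n : V) = (n : ℝ) • x + (p : V) := fun n =>
    smul_inv_smul₀ (hn n).ne' _
  have hzlim : Tendsto (fun n => (z n : V)) atTop (𝓝 x) := by
    have h1 : ∀ n, (z n : V) = x + (1 / ((n : ℝ) + 1)) • ((p : V) - x) := by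
      intro n
      have h2 : x = ((n : ℝ) + 1)⁻¹ • (((n : ℝ) + 1) • x) := (inv_smul_smul₀ (hn n).ne' x).symm
      rw [one_div]
      nth_rewrite 1 [h2]
      rw [← smul_add]
      change _ • _ = _
      congr 1
      module
    simp only [h1]
    simpa using ((tendsto_one_div_add_atTop_nhds_zero_nat (𝕜 := ℝ)).smul_const
      ((p : V) - x)).const_add x
  have hup : ∀ m n : ℕ, m ≤ n →
      D.funk (z m) (z n) ≤ Real.log (n + 1) - Real.log (m + 1) := by
    intro m n hmn
    have hzm := (z m).2.1
    rw [← Real.log_div (hn n).ne' (hn m).ne']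
    refine (C.funk_le_iff (subset_closure hzm) (C.ne_zero_of_mem hzm) (z n).2.1).mpr ?_
    rw [Real.exp_log (div_pos (hn n) (hn m))]
    have h1 : 0 ≤ ((m : ℝ) + 1)⁻¹ * (n - m) :=
      mul_nonneg (inv_pos.mpr (hn m)).le (sub_nonneg.mpr (by exact_mod_cast hmn))
    convert C.smul_mem_closure h1 hxK using 1
    rw [div_eq_inv_mul, mul_smul, hz, ← smul_smul]
    change _ - (_ : ℝ)⁻¹ • _ = _
    rw [← smul_sub]
    congr 1
    module
  -- A smaller distance would give `s < 1` with `(s * n) • x` dominating `(1 - s) • p`, forcing `x`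
  -- into the open cone.
  have hlow : ∀ n : ℕ, Real.log (n + 1) ≤ D.funk p (z n) := by
    intro n
    by_contra! hlt
    have h1 := (C.funk_le_iff (subset_closure p.2.1) hp0 (z n).2.1).mp (le_refl (C.funk p (z n)))
    set t := Real.exp (C.funk p (z n)) with ht
    have ht0 : 0 < t := Real.exp_pos _
    have htn : t < n + 1 := by
      rw [← Real.exp_log (hn n)]
      exact Real.exp_lt_exp.mpr hlt
    set s := t / (n + 1) with hs
    have hs0 : 0 < s := div_pos ht0 (hn n)
    have hs1 : s < 1 := (div_lt_one (hn n)).mpr htn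
    have h2 : t • (z n : V) = s • ((n : ℝ) • x + (p : V)) := by
      rw [← hz n, smul_smul s, hs, div_mul_cancel₀ _ (hn n).ne']
    rw [h2] at h1
    have h3 : (s * n) • x ∈ C.carrier := by
      refine C.mem_of_sub_smul_mem_closure (sub_pos.mpr hs1) p.2.1 ?_
      convert h1 using 1
      module
    rcases (mul_nonneg hs0.le (Nat.cast_nonneg n)).eq_or_lt with h0 | h0
    · rw [← h0, zero_smul] at h3
      exact C.ne_zero_of_mem h3 rfl
    · refine hxC ?_
      have h4 := C.smul_mem (inv_pos.mpr h0) h3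
      rwa [inv_smul_smul₀ h0.ne'] at h4
  have hup0 : ∀ n : ℕ, D.funk p (z n) ≤ Real.log (n + 1) := by
    intro n
    have h := hup 0 n n.zero_le
    have h0 : z 0 = p := by
      apply Subtype.ext
      simpa using hz 0
    rw [h0] at h
    simpa using h
  obtain ⟨f, hf⟩ := D.isProperDist.exists_ultrafilter_limit p (Ultrafilter.of atTop) z
  have hle : (Ultrafilter.of (atTop : Filter ℕ) : Filter ℕ) ≤ atTop := Ultrafilter.of_le _
  refine ⟨f, D.isProperDist.mem_busemannPoints_of_eventually
    (D.not_exists_funk hx (hzlim.mono_left hle) hf) hf fun ε hε => ?_,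
    D.exists_seq_of_tendsto (hzlim.mono_left hle) hf⟩
  refine Eventually.of_forall fun m => ?_
  have h1 : f (z m) ≤ -Real.log (m + 1) := by
    refine le_of_tendsto (hf (z m)) ?_
    filter_upwards [hle (eventually_ge_atTop m)] with n hmn
    linarith [hup m n hmn, hlow n]
  linarith [hup0 m]

/-- A Busemann point of the Funk geometry that is a limit of points tending to `x` is the limit of
an almost-geodesic sequence that tends to `x` in a conical way. -/
theorem exists_seq_of_mem_B (hx : x ∈ D.boundary) (hf : f ∈ D.B b x) :
    ∃ w : ℕ → D.carrier, Tendsto (fun n => (w n : V)) atTop (𝓝 x) ∧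
      (∀ y, Tendsto (fun n => C.fC b (w n) y) atTop (𝓝 (D.extend b f y))) ∧
      ∀ ε : ℝ, 0 < ε → ∀ᶠ n in atTop,
        C.funk x (w n) - C.funk x b + C.funk (w n) b < ε ∧
        D.extend b f (D.toCone (w n)) + C.funk b (w n) < ε := by
  have hxK := D.mem_closure_cone hx.1
  have hx0 := D.ne_zero_of_mem_closure hx.1
  have hx1 := D.functional_eq_one_of_mem_closure hx.1
  have hb0 := C.ne_zero_of_mem b.2
  obtain ⟨hbus, w', hw', hconv⟩ := hf
  have htr := D.extend_translate hx hw' hconv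
  obtain ⟨l, hl, hlf, hlb⟩ := D.isProperDist.eventually_of_mem_busemannPoints hbus
  obtain ⟨z, hzσ, hzf⟩ := D.isProperDist.exists_seq hlf
    (P := fun n z => D.funk (D.proj b) z + f z < 1 / ((n : ℝ) + 1))
    (fun n => hlb _ (by positivity))
  have hzg := D.tendsto_fC b hzf
  have hsub := C.sub_le_funk (fun n => (z n).2.1) hzg
  have hgb : D.extend b f b = 0 := by
    refine tendsto_nhds_unique (hzg b) (tendsto_const_nhds.congr fun n => ?_)
    rw [C.fC_eq b (z n).2.1, sub_self]
  set g := D.extend b f with hg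
  have hσ : ∀ n, C.funk b (z n) + g (D.toCone (z n)) < 1 / ((n : ℝ) + 1) := by
    intro n
    have h := D.funk_add_extend b f (D.toCone (z n))
    rw [proj_toCone] at h
    exact h.symm.trans_lt (hzσ n)
  -- The points `z n` realise the small Funk defect of `f`, but need not approach `x`. Replacing
  -- them by `x + δ n • z n` forces convergence to `x`; the norm factor makes `δ n • z n` vanish in
  -- the limit.
  let δ : ℕ → ℝ := fun n => 1 / ((n : ℝ) + 1) * (1 + ‖(z n : V)‖)⁻¹
  have hδ0 : ∀ n, 0 < δ n := fun n => by positivity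
  have hδlim : Tendsto δ atTop (𝓝 0) := by
    refine squeeze_zero (fun n => (hδ0 n).le) (fun n => ?_)
      (tendsto_one_div_add_atTop_nhds_zero_nat (𝕜 := ℝ))
    refine mul_le_of_le_one_right (by positivity) (inv_le_one_of_one_le₀ ?_)
    linarith [norm_nonneg (z n : V)]
  have hδz : Tendsto (fun n => δ n • (z n : V)) atTop (𝓝 0) := by
    refine squeeze_zero_norm (fun n => ?_) (tendsto_one_div_add_atTop_nhds_zero_nat (𝕜 := ℝ))
    rw [norm_smul, Real.norm_of_nonneg (hδ0 n).le, mul_assoc]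
    refine mul_le_of_le_one_right (by positivity) ?_
    rw [inv_mul_le_one₀ (by positivity)]
    linarith
  let q : ℕ → C.carrier := fun n =>
    ProperOpenCone.translate (ProperOpenCone.scale (D.toCone (z n)) (δ n) (hδ0 n)) hxK 1
      zero_le_one
  have hq : ∀ n, (q n : V) = x + δ n • (z n : V) := fun n => by
    change (1 : ℝ) • x + δ n • (z n : V) = _
    rw [one_smul]
  have hqφ : ∀ n, D.functional (q n) = 1 + δ n := fun n => by
    rw [hq, map_add, map_smul, hx1, (z n).2.2, smul_eq_mul, mul_one]
  have hφ0 : ∀ n, 0 < 1 + δ n := fun n => by linarith [hδ0 n]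
  have hφlim : Tendsto (fun n => 1 + δ n) atTop (𝓝 1) := by
    simpa using hδlim.const_add 1
  -- By translation invariance `g` sees only `δ n • z n`, while `q n` dominates that point, so `F(·,
  -- q n)` is no larger. The two logarithms cancel and the defect does not increase.
  have hqg : ∀ n, g (q n) = g (D.toCone (z n)) + Real.log (δ n) := fun n => by
    rw [htr, hg, extend_scale]
  have hqf : ∀ (y : C.carrier) n, C.funk y (q n) ≤ C.funk y (z n) - Real.log (δ n) := by
    intro y n
    have hy0 := C.ne_zero_of_mem y.2
    have hδzC := C.smul_mem (hδ0 n) (z n).2.1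
    rw [← C.funk_smul_right (hδ0 n) (subset_closure y.2) hy0 (z n).2.1]
    refine Real.log_le_log (C.gauge_pos (subset_closure y.2) hy0 (q n).2)
      (C.gauge_mono_right (subset_closure y.2) hy0 hδzC (q n).2 ?_)
    rw [hq, add_sub_cancel_right]
    exact hxK
  have hwq : ∀ n, (D.proj (q n) : V) = (1 + δ n)⁻¹ • (q n : V) := fun n => by
    rw [coe_proj, hqφ]
  have hlim : Tendsto (fun n => (D.proj (q n) : V)) atTop (𝓝 x) := by
    have h := (hφlim.inv₀ one_ne_zero).smul (hδz.const_add x)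
    simp only [hwq, hq]
    simpa using h
  refine ⟨fun n => D.proj (q n), hlim, fun y => ?_, fun ε hε => ?_⟩
  · have h1 : ∀ n, C.fC b (D.proj (q n)) y = C.funk y (q n) - C.funk b (q n) := fun n => by
      rw [coe_proj, C.fC_smul b (q n).2 (inv_pos.mpr (D.functional_pos (q n))),
        C.fC_eq b (q n).2]
    have h2 := tendsto_one_div_add_atTop_nhds_zero_nat (𝕜 := ℝ)
    -- Both bounds combine `g y - g y' ≤ F(y, y')` with the defect at `z n`, which costs `1 / (n +
    -- 1)`.
    refine tendsto_of_tendsto_of_tendsto_of_le_of_le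
      (g := fun n : ℕ => g y - 1 / ((n : ℝ) + 1))
      (h := fun n : ℕ => C.fC b (z n) y + 1 / ((n : ℝ) + 1))
      (by simpa using h2.const_sub (g y)) (by simpa using (hzg y).add h2) (fun n => ?_)
      (fun n => ?_)
    · show g y - 1 / ((n : ℝ) + 1) ≤ C.fC b (D.proj (q n)) y
      rw [h1]
      linarith [hsub y (q n), hqg n, hqf b n, hσ n]
    · show C.fC b (D.proj (q n)) y ≤ C.fC b (z n) y + 1 / ((n : ℝ) + 1)
      rw [h1, C.fC_eq b (z n).2.1]
      linarith [hsub b (q n), hqg n, hqf y n, hσ n]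
  · have h1 : Tendsto (fun n => Real.log (1 + δ n) - C.funk x b + C.funk (D.proj (q n)) b) atTop
        (𝓝 (Real.log 1 - C.funk x b + C.funk x b)) :=
      ((hφlim.log one_ne_zero).sub_const _).add (C.tendsto_funk_left hxK hx0 b.2
        (fun n => subset_closure (D.proj (q n)).2.1)
        (fun n => C.ne_zero_of_mem (D.proj (q n)).2.1) hlim)
    rw [Real.log_one, zero_sub, neg_add_cancel] at h1
    filter_upwards [h1.eventually_lt_const hε,
      (tendsto_one_div_add_atTop_nhds_zero_nat (𝕜 := ℝ)).eventually_lt_const hε] with n hn1 hn2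
    constructor
    -- The projected point times `1 + δ n` is `q n`, which dominates `x`. This is the conical
    -- approach that controls the `r_x` part of the defect.
    · have h2 : C.funk x (D.proj (q n)) ≤ Real.log (1 + δ n) := by
        rw [C.funk_le_iff hxK hx0 (D.proj (q n)).2.1, Real.exp_log (hφ0 n), hwq,
          smul_inv_smul₀ (hφ0 n).ne', hq, add_sub_cancel_left]
        exact subset_closure (C.smul_mem (hδ0 n) (z n).2.1)
      linarith
    · have h2 := D.funk_add_extend b f (q n)
      have h3 := D.funk_add_extend b f (D.toCone (D.proj (q n)))
      rw [proj_toCone] at h3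
      have h4 : C.funk b (D.toCone (D.proj (q n))) = C.funk b (D.proj (q n)) := rfl
      linarith [hqg n, hqf b n, hσ n]

theorem bracket_mem_busemannPoints (hx : x ∈ D.boundary) (hf : f ∈ D.B b x) (c : EReal) :
    bracket (C.r b x) (D.extend b f) c ∈ busemannPoints C.thompson b := by
  obtain ⟨w, hw, hwg, hε⟩ := D.exists_seq_of_mem_B hx hf
  have hmem := D.bracket_mem_horofunctionBoundary hx ⟨hf.1.1, hf.2⟩ c
  obtain ⟨z, hz, hz'⟩ := D.exists_seq_tendsto_bracket (D.mem_closure_cone hx.1)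
    (D.ne_zero_of_mem_closure hx.1) (fun y t => D.extend_scale b f y) hw hwg c
  refine (C.thompson_isProperDist D).mem_busemannPoints_of_eventually
    ((C.thompson_isProperDist D).mem_horofunctionBoundary_iff.mp hmem).2 hz fun ε hpos => ?_
  filter_upwards [hε ε hpos] with n hn
  exact (hz' n).trans_lt (max_lt hn.1 hn.2)

/-- If a bracket `[r_x, f, c]` with `c < ∞` is a Busemann point of the Thompson geometry, then `f`
is a Busemann point of the Funk geometry. -/
theorem mem_B_of_bracket_mem (hx : x ∈ closure D.carrier) (hf : f ∈ D.A b x) {c : EReal}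
    (hc : c ≠ ⊤)
    (hξ : bracket (C.r b x) (D.extend b f) c ∈ busemannPoints C.thompson b) : f ∈ D.B b x := by
  refine ⟨?_, hf.2⟩
  obtain ⟨l, hl, hlξ, hlb⟩ :=
    (C.thompson_isProperDist D).eventually_of_mem_busemannPoints hξ
  have hle : (Ultrafilter.of l : Filter C.carrier) ≤ l := Ultrafilter.of_le l
  -- The almost-geodesic yields its own bracket data, possibly with `x' ≠ x`; comparison under
  -- scaling shows only `f' = f` and equal positive parts of `c` and `c'`, which is enough.
  obtain ⟨x', hx', f', c', -, hf', hc', heq⟩ :=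
    D.exists_bracket_of_ultrafilter fun y => (hlξ y).mono_left hle
  let p : C.carrier → ℕ → C.carrier := fun y n =>
    ProperOpenCone.scale y (Real.exp n) (Real.exp_pos _)
  have hr : ∀ {x : V}, x ∈ closure D.carrier → ∀ y n, C.r b x (p y n) = C.r b x y - n := by
    intro x hx y n
    rw [C.r_scale b (D.mem_closure_cone hx) (D.ne_zero_of_mem_closure hx), Real.log_exp]
  have hg : ∀ (f : D.carrier → ℝ) y n, D.extend b f (p y n) = D.extend b f y + n := by
    intro f y n
    rw [extend_scale, Real.log_exp]
  have hlim := fun y => tendsto_bracket_sub hc (hr hx y) (hg f y)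
  have hct : c' ≠ ⊤ := by
    rintro rfl
    have h1 := tendsto_bracket_top_sub (f₂ := D.extend b f') (hr hx' b)
    rw [← heq] at h1
    exact not_tendsto_atBot_of_tendsto_nhds (hlim b) h1
  have hgg : ∀ y, D.extend b f y - (max c 0).toReal = D.extend b f' y - (max c' 0).toReal := by
    intro y
    refine tendsto_nhds_unique (hlim y) ?_
    rw [heq]
    exact tendsto_bracket_sub hct (hr hx' y) (hg f' y)
  have hb : ∀ {f : D.carrier → ℝ}, f (D.proj b) = 0 → D.extend b f b = 0 := by
    intro f h
    rw [extend_eq, h, sub_self, add_zero]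
  obtain ⟨-, w, -, hconv⟩ := id hf
  have hgb := hb (IsProperDist.limit_base (D.isProperDist.horoConverges_iff.mp hconv))
  have hgb' := hb (IsProperDist.limit_base hf')
  have hcc : (max c 0).toReal = (max c' 0).toReal := by
    have := hgg b
    rw [hgb, hgb'] at this
    linarith
  have hff : f = f' := D.extend_injective b (funext fun y => by
    have := hgg y
    rw [hcc] at this
    linarith)
  rw [← hff] at hf'
  refine D.isProperDist.mem_busemannPoints_of_eventually
    (D.isProperDist.mem_horofunctionBoundary_iff.mp hf.1).2 hf' fun ε hε => ?_
  have hmax : Tendsto (fun z : C.carrier => max (C.funk z b - C.funk b z) 0)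
      (Ultrafilter.of l) (𝓝 (max c 0).toReal) := by
    rw [hcc]
    have h1 : max c' 0 ≠ ⊤ := (max_lt hct.lt_top EReal.zero_lt_top).ne
    have h2 : max c' 0 ≠ ⊥ := (lt_of_lt_of_le EReal.bot_lt_zero (le_max_right c' 0)).ne'
    refine ((EReal.tendsto_toReal h1 h2).comp (hc'.max tendsto_const_nhds)).congr fun z => ?_
    simp only [Function.comp]
    rw [← EReal.coe_zero, ← EReal.coe_strictMono.monotone.map_max, EReal.toReal_coe]
  filter_upwards [hle (hlb (ε / 2) (half_pos hε)),
    hmax.eventually_const_lt (sub_lt_self _ (half_pos hε))] with z hz1 hz2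
  have hz1 : C.thompson b z + bracket (C.r b x) (D.extend b f) c z < ε / 2 := hz1
  rw [D.funk_add_extend]
  -- The Funk defect is the Thompson defect after trading this positive part for its limit `c⁺`,
  -- which the bracket subtracts from `f`.
  have h1 : C.thompson b z = C.funk b z + max (C.funk z b - C.funk b z) 0 := by
    rw [C.thompson_eq, ← max_add_add_left, add_zero, max_comm]
    congr 1
    ring
  have h2 := le_bracket (f₁ := C.r b x) (f₂ := D.extend b f) (y := z) hc
  linarith

theorem exists_of_mem_horofunctionBoundary {ξ : C.carrier → ℝ}
    (hξ : ξ ∈ horofunctionBoundary C.thompson b) :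
    (∃ x ∈ D.carrier, ξ = C.r b x) ∨ (∃ x ∈ D.carrier, ξ = C.fC b x) ∨
      ∃ x ∈ D.boundary, ∃ f ∈ D.A b x, ∃ c : EReal, ξ = bracket (C.r b x) (D.extend b f) c := by
  obtain ⟨⟨u, hu⟩, hnot⟩ := (C.thompson_isProperDist D).mem_horofunctionBoundary_iff.mp hξ
  obtain ⟨x, hx, f, c, hlim, hf, -, heq⟩ := D.exists_bracket_of_ultrafilter hu
  by_cases hxD : x ∈ D.carrier
  · have hff : ∀ y, f y = D.funk y ⟨x, hxD⟩ - D.funk (D.proj b) ⟨x, hxD⟩ := by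
      have key : ∀ y : D.carrier, Tendsto (fun z : C.carrier => C.funk y (D.proj z)) u
          (𝓝 (C.funk y x)) := fun y =>
        C.tendsto_funk_right (subset_closure y.2.1) (C.ne_zero_of_mem y.2.1) hxD.1 hlim
      exact fun y => tendsto_nhds_unique (hf y) ((key y).sub (key (D.proj b)))
    have hfC : D.extend b f = C.fC b x := D.extend_eq_fC b (w := ⟨x, hxD⟩) hff
    rw [hfC] at heq
    induction c with
    | top => exact Or.inl ⟨x, hxD, by rw [heq, bracket_top]⟩
    | bot => exact Or.inr (Or.inl ⟨x, hxD, by rw [heq, bracket_bot]⟩)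
    | coe c =>
      refine absurd ?_ hnot
      -- The multiple of `x` whose own value of `F(·, b) - F(b, ·)` is `c`; the bracket is then the
      -- function of that point.
      set s := Real.exp ((c - (C.funk x b - C.funk b x)) / 2) with hs
      have hs0 : 0 < s := Real.exp_pos _
      refine ⟨⟨s • x, C.smul_mem hs0 hxD.1⟩, fun y => ?_⟩
      have hx0 := C.ne_zero_of_mem hxD.1
      rw [heq, bracket_coe, C.thompson_sub]
      have h1 : C.funk (s • x) b - C.funk b (s • x) = c := by
        rw [C.funk_smul_left hs0 (subset_closure hxD.1) hx0 b.2,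
          C.funk_smul_right hs0 (subset_closure b.2) (C.ne_zero_of_mem b.2) hxD.1, hs,
          Real.log_exp]
        ring
      simp only [h1, C.fC_smul b hxD.1 hs0, C.r_smul b hxD.1 hs0]
  · have hxb : x ∈ D.boundary := ⟨hx, hxD⟩
    exact Or.inr (Or.inr ⟨x, hxb, f, ⟨D.isProperDist.mem_horofunctionBoundary_of_tendsto hf
      (D.not_exists_funk hxb hlim hf), D.exists_seq_of_tendsto hlim hf⟩, c, heq⟩)

end CrossSection

end ThompsonHoro

theorem mainTheorem6 {V : Type*} [NormedAddCommGroup V] [NormedSpace ℝ V] [FiniteDimensional ℝ V]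
    [Nontrivial V] (C : ThompsonHoro.ProperOpenCone V) (D : ThompsonHoro.CrossSection C)
    (b : C.carrier) :
    ThompsonHoro.horofunctionBoundary C.thompson b =
      {ξ | ∃ x ∈ D.carrier, ξ = C.r b x} ∪ {ξ | ∃ x ∈ D.carrier, ξ = C.fC b x} ∪
        {ξ | ∃ x ∈ D.boundary, ∃ f ∈ D.A b x, ∃ c : EReal,
          ξ = ThompsonHoro.bracket (C.r b x) (D.extend b f) c} ∧
    ThompsonHoro.busemannPoints C.thompson b =
      {ξ | ∃ x ∈ D.carrier, ξ = C.r b x} ∪ {ξ | ∃ x ∈ D.carrier, ξ = C.fC b x} ∪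
        {ξ | ∃ x ∈ D.boundary, ∃ f ∈ D.B b x, ∃ c : EReal,
          ξ = ThompsonHoro.bracket (C.r b x) (D.extend b f) c} := by
  have hr : ∀ x ∈ D.carrier, C.r b x ∈ ThompsonHoro.busemannPoints C.thompson b := by
    intro x hx
    have h := D.bracket_mem_busemannPoints_of_mem (b := b) ⟨x, hx⟩ (Or.inl rfl)
    rwa [ThompsonHoro.bracket_top] at h
  have hfC : ∀ x ∈ D.carrier, C.fC b x ∈ ThompsonHoro.busemannPoints C.thompson b := by
    intro x hx
    have h := D.bracket_mem_busemannPoints_of_mem (b := b) ⟨x, hx⟩ (Or.inr rfl)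
    rwa [ThompsonHoro.bracket_bot] at h
  constructor
  · refine Subset.antisymm (fun ξ hξ => ?_) ?_
    · rw [union_assoc]
      exact D.exists_of_mem_horofunctionBoundary hξ
    · rintro ξ ((⟨x, hx, rfl⟩ | ⟨x, hx, rfl⟩) | ⟨x, hx, f, hf, c, rfl⟩)
      exacts [(hr x hx).1, (hfC x hx).1, D.bracket_mem_horofunctionBoundary hx hf c]
  · refine Subset.antisymm (fun ξ hξ => ?_) ?_
    · rw [union_assoc]
      refine (D.exists_of_mem_horofunctionBoundary hξ.1).imp_right (Or.imp_right ?_)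
      rintro ⟨x, hx, f, hf, c, rfl⟩
      -- For `c = ⊤` the given `f` may fail to be Busemann, but the bracket ignores it, so any
      -- element of `B(x)` serves instead.
      rcases eq_or_ne c ⊤ with rfl | hc
      · obtain ⟨f', hf'⟩ := D.B_nonempty (b := b) hx
        exact ⟨x, hx, f', hf', ⊤, by rw [ThompsonHoro.bracket_top, ThompsonHoro.bracket_top]⟩
      · exact ⟨x, hx, f, D.mem_B_of_bracket_mem hx.1 hf hc hξ, c, rfl⟩
    · rintro ξ ((⟨x, hx, rfl⟩ | ⟨x, hx, rfl⟩) | ⟨x, hx, f, hf, c, rfl⟩)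
      exacts [hr x hx, hfC x hx, D.bracket_mem_busemannPoints hx hf c]
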